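/- Let $\nu>2$, $\lambda>0$ and $p>\frac{\nu+2}{\nu-2}$ be real numbers. For each $\alpha>0$ the initial value problem $$u''(r)+(\nu-1)\frac{u'(r)}{r}=-\frac{u(r)^p}{\lambda}\quad (r>1),\qquad u(1)=0,\quad u'(1)=\alpha,$$ has a unique maximal positive solution $u_\alpha$, i.e. a solution with $u_\alpha>0$ on $(1,\rho_\alpha)$, defined on a maximal interval $[1,\rho_\alpha)$ with $1<\rho_\alpha\le+\infty$. The set $D=\{\alpha>0:\rho_\alpha<+\infty\}$ is nonempty; put $\alpha^*=\inf D$. Then: (i) $\alpha^*>0$; (ii) if $\alpha>\alpha^*$, then $\rho_\alpha<+\infty$, and $u_\alpha(r)\to 0$ as $r\to\rho_\alpha^-$; (iii) $\rho_{\alpha^*}=+\infty$ and $\lim_{r\to+\infty}r^{\nu-2}u_{\alpha^*}(r)=C$ for some constant $C>0$; moreover $\alpha^*$ is the only $\alpha>0$ such that $\rho_\alpha=+\infty$ and $\lim_{r\to+\infty}r^{\nu-2}u_\alpha(r)$ exists in $(0,+\infty)$; (iv) if $0<\alpha<\alpha^*$, then $\rho_\alpha=+\infty$ and $$\lim_{r\to+\infty}r^{\frac{2}{p-1}}u_\alpha(r)=\left(\frac{2\lambda\,((\nu-2)p-\nu)}{(p-1)^2}\right)^{\frac1{p-1}}.$$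 -/

import Mathlib

open Filter Topology Set

/-- `u` is a positive solution on `[1, ρ)`, `1 < ρ ≤ +∞`, of
`u'' + (ν - 1) u' / r = - u ^ p / lam` for `r > 1`, `u(1) = 0`, `u'(1) = α`.
The function `v` is the derivative `u'`, one-sided and continuous at `r = 1`.
Values of `u` outside `[1, ρ)` are irrelevant. -/
structure IsPositiveSolution (ν p lam α : ℝ) (ρ : EReal) (u : ℝ → ℝ) : Prop where
  one_lt : 1 < ρ
  pos : ∀ r : ℝ, 1 < r → (r : EReal) < ρ → 0 < u r
  initial : u 1 = 0
  ode : ∃ v : ℝ → ℝ,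
    (∀ r : ℝ, 1 ≤ r → (r : EReal) < ρ → HasDerivWithinAt u (v r) (Ici 1) r) ∧
    v 1 = α ∧ ContinuousWithinAt v (Ici 1) 1 ∧
    ∀ r : ℝ, 1 < r → (r : EReal) < ρ →
      ∃ w : ℝ, HasDerivAt v w r ∧ w + (ν - 1) * (v r / r) = -(u r ^ p / lam)

/-- `u` on `[1, ρ)` is a maximal positive solution: it is a positive solution and no positive
solution on a strictly larger interval `[1, ρ')` extends it. -/
structure IsMaximalPositiveSolution (ν p lam α : ℝ) (ρ : EReal) (u : ℝ → ℝ) : Prop where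
  sol : IsPositiveSolution ν p lam α ρ u
  maximal : ∀ (ρ' : EReal) (w : ℝ → ℝ), IsPositiveSolution ν p lam α ρ' w → ρ ≤ ρ' →
    (∀ r : ℝ, 1 ≤ r → (r : EReal) < ρ → w r = u r) → ρ' = ρ

/-- The set of the slopes `α > 0` whose maximal positive solution lives on a bounded interval. -/
def crossingSlopes (ν p lam : ℝ) : Set ℝ :=
  {α | 0 < α ∧ ∃ (ρ : EReal) (u : ℝ → ℝ), IsMaximalPositiveSolution ν p lam α ρ u ∧ ρ < ⊤}

/-- The critical slope `α^*`. -/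
noncomputable def criticalSlope (ν p lam : ℝ) : ℝ := sInf (crossingSlopes ν p lam)

/-! ### Monotonicity and limit lemmas on real functions -/

/-! Put m = 2/(p-1), k = ν-2-m, c = 1/λ. The substitution x(t) = r^m u(r), r = e^t, turns the radial
problem into the autonomous oscillator x'' + (k-m) x' - mk x + c x^p = 0 started at (0, α).
Supercriticality of p means k > m, so the friction is positive and the energy y²/2 + V(x), with y =
x', never increases. The potential V is negative just to the right of 0 and coercive at +∞. Force
and potential are cut off to 0 for x ≤ 0: trajectories are then global, and one that has crossed x =
0 never comes back.

Every slope α > 0 is of one of three kinds. Crossing: x becomes negative, and ρ is finite. Trapped: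
the energy becomes negative, so x cannot return to 0 and converges to the equilibrium
(mk/c)^(1/(p-1)), which is the slow decay of u (`tendsto_x_equilibrium`). Otherwise x stays positive
with nonnegative energy; then the trajectory runs into the saddle at the origin along its stable
direction, with eigenvalue -k, and e^(kt) x(t) has a positive limit, which is the fast decay r^(2-ν)
of u (`tendsto_x_zero`, `tendsto_exp_mul`). All limits rest on `tendsto_y_force`: velocity and force
die out because the dissipated energy is finite.

Crossing and trapped slopes form disjoint open sets. Small slopes are trapped
(`exists_energy_neg_of_small`) and some slope crosses (`exists_slope_not_pos`), so connectedness of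
(0, ∞) yields a slope a of the third kind. There is only one, because the stable branch of a saddle
is unique (`slope_unique`). Connectedness of (0, a) and (a, ∞) then gives `exists_separating_slope`,
and a is the critical slope. -/

lemma antitoneOn_of_hasDerivAt_nonpos {D : Set ℝ} (hD : Convex ℝ D) {f f' : ℝ → ℝ}
    (hf : ∀ t ∈ D, HasDerivAt f (f' t) t) (hf' : ∀ t ∈ D, f' t ≤ 0) : AntitoneOn f D :=
  antitoneOn_of_deriv_nonpos hD (fun t ht => (hf t ht).continuousAt.continuousWithinAt)
    (fun t ht => (hf t (interior_subset ht)).differentiableAt.differentiableWithinAt)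
    (fun t ht => by rw [(hf t (interior_subset ht)).deriv]; exact hf' t (interior_subset ht))

lemma monotoneOn_of_hasDerivAt_nonneg {D : Set ℝ} (hD : Convex ℝ D) {f f' : ℝ → ℝ}
    (hf : ∀ t ∈ D, HasDerivAt f (f' t) t) (hf' : ∀ t ∈ D, 0 ≤ f' t) : MonotoneOn f D :=
  monotoneOn_of_deriv_nonneg hD (fun t ht => (hf t ht).continuousAt.continuousWithinAt)
    (fun t ht => (hf t (interior_subset ht)).differentiableAt.differentiableWithinAt)
    (fun t ht => by rw [(hf t (interior_subset ht)).deriv]; exact hf' t (interior_subset ht))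

lemma strictAntiOn_of_hasDerivAt_neg {D : Set ℝ} (hD : Convex ℝ D) {f f' : ℝ → ℝ}
    (hf : ∀ t ∈ D, HasDerivAt f (f' t) t) (hf' : ∀ t ∈ D, f' t < 0) : StrictAntiOn f D :=
  strictAntiOn_of_deriv_neg hD (fun t ht => (hf t ht).continuousAt.continuousWithinAt)
    (fun t ht => by rw [(hf t (interior_subset ht)).deriv]; exact hf' t (interior_subset ht))

lemma strictMonoOn_of_hasDerivAt_pos {D : Set ℝ} (hD : Convex ℝ D) {f f' : ℝ → ℝ}
    (hf : ∀ t ∈ D, HasDerivAt f (f' t) t) (hf' : ∀ t ∈ D, 0 < f' t) : StrictMonoOn f D :=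
  strictMonoOn_of_deriv_pos hD (fun t ht => (hf t ht).continuousAt.continuousWithinAt)
    (fun t ht => by rw [(hf t (interior_subset ht)).deriv]; exact hf' t (interior_subset ht))

/-- If `φ` converges at infinity and its derivative is Lipschitz, the derivative tends to `0`. -/
lemma tendsto_deriv_zero_of_tendsto {φ ψ : ℝ → ℝ} {L K : ℝ}
    (hφ : Tendsto φ atTop (𝓝 L)) (hd : ∀ t, 0 ≤ t → HasDerivAt φ (ψ t) t)
    (hK : ∀ s t, 0 ≤ s → s ≤ t → |ψ t - ψ s| ≤ K * (t - s)) : Tendsto ψ atTop (𝓝 0) := by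
  have hK0 : 0 ≤ K := by
    have := hK 0 1 le_rfl zero_le_one
    have h2 := abs_nonneg (ψ 1 - ψ 0)
    linarith
  rw [Metric.tendsto_atTop]
  intro ε hε
  -- A window so short that ψ varies by less than ε/2 on it. Convergence of φ makes the mean of ψ
  -- over late windows small, and the mean value theorem turns this into a point where ψ is small.
  set h : ℝ := ε / (2 * (K + 1)) with hh
  have hh0 : 0 < h := by positivity
  have hKh : K * h < ε / 2 := by
    rw [hh, mul_div_assoc', div_lt_div_iff₀ (by positivity) (by positivity)]
    nlinarith
  have hshift : Tendsto (fun t => φ (t + h) - φ t) atTop (𝓝 0) := by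
    have h1 : Tendsto (fun t => φ (t + h)) atTop (𝓝 L) :=
      hφ.comp (tendsto_atTop_add_const_right _ _ tendsto_id)
    simpa using h1.sub hφ
  obtain ⟨N, hN⟩ := (Metric.tendsto_atTop.1 hshift) (h * (ε / 2)) (by positivity)
  refine ⟨max N 0, fun t ht => ?_⟩
  have ht0 : 0 ≤ t := le_trans (le_max_right _ _) ht
  have hNt := hN t (le_trans (le_max_left _ _) ht)
  rw [Real.dist_eq, sub_zero] at hNt ⊢
  obtain ⟨ξ, hξ, hξe⟩ := exists_hasDerivAt_eq_slope φ ψ (by linarith : t < t + h)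
    (fun s hs => (hd s (ht0.trans hs.1)).continuousAt.continuousWithinAt)
    (fun s hs => hd s (ht0.trans hs.1.le))
  have e1 : ψ ξ * h = φ (t + h) - φ t := by
    rw [hξe, add_sub_cancel_left, div_mul_cancel₀ _ hh0.ne']
  have e2 := hK t ξ ht0 hξ.1.le
  have e3 : K * (ξ - t) ≤ K * h := by
    apply mul_le_mul_of_nonneg_left _ hK0
    linarith [hξ.2]
  have e4 : |ψ ξ| < ε / 2 := by
    have : |ψ ξ| * h < h * (ε / 2) := by
      rw [← abs_of_pos hh0, ← abs_mul, e1, abs_of_pos hh0]; exact hNt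
    nlinarith
  have := abs_sub_abs_le_abs_sub (ψ t) (ψ ξ)
  rw [abs_sub_comm] at this
  linarith

/-- An antitone function on `[T, ∞)` that is bounded below converges. -/
lemma exists_tendsto_of_antitoneOn_Ici {f : ℝ → ℝ} {T B : ℝ} (hf : AntitoneOn f (Ici T))
    (hB : ∀ t, T ≤ t → B ≤ f t) :
    ∃ L, Tendsto f atTop (𝓝 L) ∧ ∀ t, T ≤ t → L ≤ f t := by
  have hanti : Antitone (fun t => f (max t T)) := fun s t hst =>
    hf (mem_Ici.2 (le_max_right _ _)) (mem_Ici.2 (le_max_right _ _)) (max_le_max_right _ hst)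
  have hbdd : BddBelow (range fun t => f (max t T)) :=
    ⟨B, by rintro _ ⟨t, rfl⟩; exact hB _ (le_max_right _ _)⟩
  have h1 := tendsto_atTop_ciInf hanti hbdd
  refine ⟨_, h1.congr' ?_, fun t ht => ?_⟩
  · filter_upwards [eventually_ge_atTop T] with t ht
    rw [max_eq_left ht]
  · refine (ciInf_le hbdd t).trans ?_
    simp [max_eq_left ht]

/-- A continuous function on `[a, b]` that is positive at `a` and nonpositive at `b` has a first zero. -/
lemma exists_first_nonpos {f : ℝ → ℝ} {a b : ℝ} (hf : ContinuousOn f (Icc a b)) (hab : a ≤ b)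
    (ha : 0 < f a) (hb : f b ≤ 0) :
    ∃ s, a < s ∧ s ≤ b ∧ f s = 0 ∧ ∀ t, a ≤ t → t < s → 0 < f t := by
  set S := Icc a b ∩ f ⁻¹' (Iic 0) with hS
  have hcl : IsClosed S := hf.preimage_isClosed_of_isClosed isClosed_Icc isClosed_Iic
  have hne : S.Nonempty := ⟨b, ⟨hab, le_rfl⟩, hb⟩
  have hbd : BddBelow S := ⟨a, fun t ht => ht.1.1⟩
  have hmem := hcl.csInf_mem hne hbd
  set s := sInf S
  have hlt : ∀ t, a ≤ t → t < s → 0 < f t := by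
    intro t h1 h2
    by_contra h
    exact absurd (csInf_le hbd (show t ∈ S from ⟨⟨h1, h2.le.trans hmem.1.2⟩, not_lt.1 h⟩))
      (not_le.2 h2)
  have has : a < s := by
    rcases hmem.1.1.lt_or_eq with h | h
    · exact h
    · exfalso; rw [h] at ha; exact absurd hmem.2 (not_le.2 ha)
  refine ⟨s, has, hmem.1.2, le_antisymm hmem.2 ?_, hlt⟩
  have hcw : ContinuousWithinAt f (Ico a s) s :=
    (hf s hmem.1).mono (fun t ht => ⟨ht.1, ht.2.le.trans hmem.1.2⟩)
  have : s ∈ closure (Ico a s) := by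
    rw [closure_Ico has.ne]; exact ⟨has.le, le_rfl⟩
  have hnb : (𝓝[Ico a s] s).NeBot := mem_closure_iff_nhdsWithin_neBot.1 this
  refine ge_of_tendsto hcw ?_
  filter_upwards [self_mem_nhdsWithin] with t ht using (hlt t ht.1 ht.2).le

/-! ### The positive part of a power -/

/-- Since q > 1, the power leaves 0 with slope 0, so the extension by zero has no corner there. -/
lemma hasDerivAt_max_zero_rpow {q : ℝ} (hq : 1 < q) (x : ℝ) :
    HasDerivAt (fun x : ℝ => (max x 0) ^ q) (q * (max x 0) ^ (q - 1)) x := by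
  have hq0 : q ≠ 0 := by linarith
  have hq1 : q - 1 ≠ 0 := by linarith
  rcases lt_trichotomy x 0 with hx | rfl | hx
  · rw [max_eq_right hx.le, Real.zero_rpow hq1, mul_zero]
    refine (hasDerivAt_const x (0 : ℝ)).congr_of_eventuallyEq ?_
    filter_upwards [Iio_mem_nhds hx] with t ht
    rw [max_eq_right (le_of_lt ht), Real.zero_rpow hq0]
  · rw [max_self, Real.zero_rpow hq1, mul_zero]
    have h1 : HasDerivAt (fun x : ℝ => x ^ q) (q * 0 ^ (q - 1)) 0 :=
      Real.hasDerivAt_rpow_const (Or.inr hq.le)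
    rw [Real.zero_rpow hq1, mul_zero, hasDerivAt_iff_isLittleO] at h1
    rw [hasDerivAt_iff_isLittleO]
    simp only [smul_zero, sub_zero, max_self, Real.zero_rpow hq0] at h1 ⊢
    have h2 : Tendsto (fun x : ℝ => max x 0) (𝓝 0) (𝓝 0) := by
      have : Continuous (fun x : ℝ => max x 0) := by fun_prop
      simpa using this.tendsto 0
    refine (h1.comp_tendsto h2).trans_isBigO ?_
    refine Asymptotics.IsBigO.of_bound 1 (Eventually.of_forall fun t => ?_)
    simp only [Function.comp, Real.norm_eq_abs, one_mul]
    rcases le_total t 0 with h | h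
    · rw [max_eq_right h]; simp
    · rw [max_eq_left h]
  · rw [max_eq_left hx.le]
    refine (Real.hasDerivAt_rpow_const (Or.inl hx.ne')).congr_of_eventuallyEq ?_
    filter_upwards [Ioi_mem_nhds hx] with t ht
    rw [max_eq_left (le_of_lt ht)]

/-- The derivative vanishes on the negative half-line, so an upper bound on the argument is enough.
Hence only upper bounds on x are ever needed for uniqueness and continuous dependence. -/
lemma lipschitzOnWith_max_zero_rpow {q : ℝ} (hq : 1 < q) (M : ℝ) :
    ∃ K, LipschitzOnWith K (fun x : ℝ => (max x 0) ^ q) (Iic M) := by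
  refine ⟨(q * (max M 0) ^ (q - 1)).toNNReal, ?_⟩
  refine (convex_Iic M).lipschitzOnWith_of_nnnorm_hasDerivWithin_le
    (fun x _ => (hasDerivAt_max_zero_rpow hq x).hasDerivWithinAt) (fun x hx => ?_)
  have h0 : (0:ℝ) ≤ q * (max x 0) ^ (q - 1) := by positivity
  rw [← NNReal.coe_le_coe, coe_nnnorm, Real.norm_of_nonneg h0, Real.coe_toNNReal _ (by positivity)]
  have : max x 0 ≤ max M 0 := max_le_max_right _ hx
  gcongr

/-! ### The damped oscillator `x'' + (k - m) x' + force x = 0` -/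

/-- The restoring force, extended by zero to the negative half-line. -/
noncomputable def force (m k c p x : ℝ) : ℝ := c * (max x 0) ^ p - m * k * max x 0

/-- The primitive of `force` that vanishes on the negative half-line. -/
noncomputable def potential (m k c p x : ℝ) : ℝ :=
  c / (p + 1) * (max x 0) ^ (p + 1) - m * k / 2 * (max x 0) ^ (2 : ℝ)

/-- The admissible parameters of the oscillator. -/
structure Admissible (m k c p : ℝ) : Prop where
  m_pos : 0 < m
  m_lt_k : m < k
  c_pos : 0 < c
  one_lt_p : 1 < p

/-- The phase curve `(x, y)` of the oscillator that starts at `(0, α)`. -/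
structure IsTrajectory (m k c p α : ℝ) (x y : ℝ → ℝ) : Prop where
  x_zero : x 0 = 0
  y_zero : y 0 = α
  deriv_x : ∀ t, 0 ≤ t → HasDerivAt x (y t) t
  deriv_y : ∀ t, 0 ≤ t → HasDerivAt y (-(k - m) * y t - force m k c p (x t)) t

/-- The energy of the oscillator. -/
noncomputable def energy (m k c p x y : ℝ) : ℝ := y ^ 2 / 2 + potential m k c p x

/-- The vector field of the oscillator. -/
noncomputable def oscField (m k c p : ℝ) (z : ℝ × ℝ) : ℝ × ℝ :=
  (z.2, -(k - m) * z.2 - force m k c p z.1)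

section
variable {m k c p : ℝ}

lemma Admissible.k_pos (h : Admissible m k c p) : 0 < k := h.m_pos.trans h.m_lt_k

lemma Admissible.damping_pos (h : Admissible m k c p) : 0 < k - m := sub_pos.2 h.m_lt_k

lemma force_of_nonpos (h : Admissible m k c p) {x : ℝ} (hx : x ≤ 0) : force m k c p x = 0 := by
  have : p ≠ 0 := by linarith [h.one_lt_p]
  simp [force, max_eq_right hx, Real.zero_rpow this]

lemma force_of_nonneg {x : ℝ} (hx : 0 ≤ x) : force m k c p x = c * x ^ p - m * k * x := by
  simp [force, max_eq_left hx]

lemma potential_of_nonpos (h : Admissible m k c p) {x : ℝ} (hx : x ≤ 0) :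
    potential m k c p x = 0 := by
  have : p + 1 ≠ 0 := by linarith [h.one_lt_p]
  simp [potential, max_eq_right hx, Real.zero_rpow this]

lemma potential_of_nonneg {x : ℝ} (hx : 0 ≤ x) :
    potential m k c p x = c / (p + 1) * x ^ (p + 1) - m * k / 2 * x ^ 2 := by
  simp [potential, max_eq_left hx]

lemma hasDerivAt_potential (h : Admissible m k c p) (x : ℝ) :
    HasDerivAt (potential m k c p) (force m k c p x) x := by
  have hp := h.one_lt_p
  have h1 := (hasDerivAt_max_zero_rpow (by linarith : 1 < p + 1) x).const_mul (c / (p + 1))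
  have h2 := (hasDerivAt_max_zero_rpow (by norm_num : (1:ℝ) < 2) x).const_mul (m * k / 2)
  refine (h1.sub h2).congr_deriv ?_
  have e1 : p + 1 - 1 = p := by ring
  have e2 : (2:ℝ) - 1 = 1 := by norm_num
  have e3 : p + 1 ≠ 0 := by linarith
  rw [e1, e2, Real.rpow_one, force]
  field_simp

lemma continuous_potential (h : Admissible m k c p) : Continuous (potential m k c p) :=
  continuous_iff_continuousAt.2 fun x => (hasDerivAt_potential h x).continuousAt

lemma lipschitzOnWith_force (h : Admissible m k c p) (M : ℝ) :
    ∃ K, LipschitzOnWith K (force m k c p) (Iic M) := by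
  obtain ⟨K, hK⟩ := lipschitzOnWith_max_zero_rpow h.one_lt_p M
  have h1 : LipschitzOnWith _ (fun x : ℝ => c * (max x 0) ^ p) (Iic M) :=
    (lipschitzWith_smul c).lipschitzOnWith (s := univ) |>.comp hK (mapsTo_univ _ _)
  have h3 : LipschitzWith 1 (fun x : ℝ => max x 0) := LipschitzWith.id.max_const 0
  have h2 : LipschitzOnWith _ (fun x : ℝ => m * k * max x 0) (Iic M) :=
    ((lipschitzWith_smul (m * k)).comp h3).lipschitzOnWith
  exact ⟨_, h1.sub h2⟩

lemma continuous_force (h : Admissible m k c p) : Continuous (force m k c p) := by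
  unfold force
  have : (0:ℝ) ≤ p := by linarith [h.one_lt_p]
  exact (continuous_const.mul ((continuous_id.max continuous_const).rpow_const
    fun _ => Or.inr this)).sub (by fun_prop)

/-- `(p + 1) V(x) = x f(x) - (p - 1) / 2 · m k x²`. -/
lemma potential_eq (h : Admissible m k c p) {x : ℝ} (hx : 0 ≤ x) :
    potential m k c p x =
      x * force m k c p x / (p + 1) - m * k * (p - 1) / (2 * (p + 1)) * x ^ 2 := by
  have hp := h.one_lt_p
  have e3 : p + 1 ≠ 0 := by linarith
  rw [potential_of_nonneg hx, force_of_nonneg hx]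
  have : x ^ (p + 1) = x ^ p * x := by
    rcases hx.eq_or_lt with rfl | hx
    · rw [Real.zero_rpow e3]; ring
    · rw [Real.rpow_add_one hx.ne']
  rw [this]; field_simp; ring

/-- The potential is coercive on the positive half-line. -/
lemma exists_lt_potential (h : Admissible m k c p) (A : ℝ) :
    ∃ M, 0 < M ∧ ∀ x, M ≤ x → A < potential m k c p x := by
  have hp := h.one_lt_p
  have hc := h.c_pos
  have h1 : Tendsto (fun x : ℝ => c / (p + 1) * x ^ (p - 1) - m * k / 2) atTop atTop := by
    apply tendsto_atTop_add_const_right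
    exact (tendsto_rpow_atTop (by linarith : 0 < p - 1)).const_mul_atTop
      (div_pos hc (by linarith))
  have h2 := (tendsto_pow_atTop (α := ℝ) two_ne_zero).atTop_mul_atTop₀ h1
  have h3 := (h2.eventually_gt_atTop A).and (eventually_gt_atTop 0)
  obtain ⟨M, hM⟩ := eventually_atTop.1 h3
  refine ⟨max M 1, by positivity, fun x hx => ?_⟩
  obtain ⟨h4, h5⟩ := hM x ((le_max_left _ _).trans hx)
  rw [potential_of_nonneg h5.le]
  refine h4.trans_eq ?_
  have : x ^ (p + 1) = x ^ (p - 1) * x ^ 2 := by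
    rw [← Real.rpow_natCast x 2, ← Real.rpow_add h5]; congr 1; push_cast; ring
  rw [this]; ring

/-- The potential is bounded below. -/
lemma exists_le_potential (h : Admissible m k c p) :
    ∃ B, 0 ≤ B ∧ ∀ x, -B ≤ potential m k c p x := by
  obtain ⟨M, hM0, hM⟩ := exists_lt_potential h 0
  obtain ⟨C, hC⟩ := isCompact_Icc.exists_bound_of_continuousOn
    (continuous_potential h).continuousOn (s := Icc 0 M)
  have hC0 : 0 ≤ C := (norm_nonneg _).trans (hC 0 ⟨le_rfl, hM0.le⟩)
  refine ⟨C, hC0, fun x => ?_⟩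
  rcases le_total x 0 with hx | hx
  · rw [potential_of_nonpos h hx]; linarith
  · rcases le_total x M with hx' | hx'
    · exact (abs_le.1 (hC x ⟨hx, hx'⟩)).1
    · linarith [hM x hx']

lemma lipschitzOnWith_oscField (h : Admissible m k c p) (M : ℝ) :
    ∃ K, LipschitzOnWith K (oscField m k c p) {z | z.1 ≤ M} := by
  obtain ⟨K, hK⟩ := lipschitzOnWith_force h M
  have h1 : LipschitzOnWith 1 (Prod.snd : ℝ × ℝ → ℝ) {z | z.1 ≤ M} :=
    LipschitzWith.prod_snd.lipschitzOnWith
  have h2 : LipschitzOnWith (K * 1) (fun z : ℝ × ℝ => force m k c p z.1) {z | z.1 ≤ M} :=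
    hK.comp LipschitzWith.prod_fst.lipschitzOnWith (fun z hz => hz)
  have h3 : LipschitzOnWith _ (fun z : ℝ × ℝ => -(k - m) * z.2) {z | z.1 ≤ M} :=
    ((lipschitzWith_smul (-(k - m))).comp LipschitzWith.prod_snd).lipschitzOnWith
  exact ⟨_, h1.prodMk (h3.sub h2)⟩

/-! ### Uniqueness -/

/-- Stated with right derivatives because the transform of a radial solution is controlled only to
the right of its starting time. -/
lemma oscillator_unique_right (h : Admissible m k c p) {x₁ y₁ x₂ y₂ : ℝ → ℝ} {a b : ℝ}
    (hx₁ : ContinuousOn x₁ (Icc a b)) (hy₁ : ContinuousOn y₁ (Icc a b))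
    (hx₂ : ContinuousOn x₂ (Icc a b)) (hy₂ : ContinuousOn y₂ (Icc a b))
    (dx₁ : ∀ t ∈ Ico a b, HasDerivWithinAt x₁ (y₁ t) (Ici t) t)
    (dy₁ : ∀ t ∈ Ico a b,
      HasDerivWithinAt y₁ (-(k - m) * y₁ t - force m k c p (x₁ t)) (Ici t) t)
    (dx₂ : ∀ t ∈ Ico a b, HasDerivWithinAt x₂ (y₂ t) (Ici t) t)
    (dy₂ : ∀ t ∈ Ico a b,
      HasDerivWithinAt y₂ (-(k - m) * y₂ t - force m k c p (x₂ t)) (Ici t) t)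
    (ex : x₁ a = x₂ a) (ey : y₁ a = y₂ a) :
    ∀ t ∈ Icc a b, x₁ t = x₂ t ∧ y₁ t = y₂ t := by
  obtain ⟨C₁, hC₁⟩ := isCompact_Icc.exists_bound_of_continuousOn hx₁
  obtain ⟨C₂, hC₂⟩ := isCompact_Icc.exists_bound_of_continuousOn hx₂
  obtain ⟨K, hK⟩ := lipschitzOnWith_oscField h (max C₁ C₂)
  have := ODE_solution_unique_of_mem_Icc_right (v := fun _ => oscField m k c p)
    (s := fun _ => {z | z.1 ≤ max C₁ C₂}) (f := fun t => (x₁ t, y₁ t)) (g := fun t => (x₂ t, y₂ t))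
    (a := a) (b := b) (fun _ _ => hK) (hx₁.prodMk hy₁)
    (fun t ht => (dx₁ t ht).prodMk (dy₁ t ht))
    (fun t ht => (le_abs_self _).trans ((hC₁ t (Ico_subset_Icc_self ht)).trans (le_max_left _ _)))
    (hx₂.prodMk hy₂) (fun t ht => (dx₂ t ht).prodMk (dy₂ t ht))
    (fun t ht => (le_abs_self _).trans ((hC₂ t (Ico_subset_Icc_self ht)).trans (le_max_right _ _)))
    (by simp [ex, ey])
  intro t ht
  simpa using this ht

/-- Needed backwards in time to show that the rest point at the origin is not reached in finite
time, and to trace two trajectories that meet back to their starting points. -/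
lemma oscillator_unique_left (h : Admissible m k c p) {x₁ y₁ x₂ y₂ : ℝ → ℝ} {a b : ℝ}
    (dx₁ : ∀ t ∈ Icc a b, HasDerivAt x₁ (y₁ t) t)
    (dy₁ : ∀ t ∈ Icc a b, HasDerivAt y₁ (-(k - m) * y₁ t - force m k c p (x₁ t)) t)
    (dx₂ : ∀ t ∈ Icc a b, HasDerivAt x₂ (y₂ t) t)
    (dy₂ : ∀ t ∈ Icc a b, HasDerivAt y₂ (-(k - m) * y₂ t - force m k c p (x₂ t)) t)
    (ex : x₁ b = x₂ b) (ey : y₁ b = y₂ b) :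
    ∀ t ∈ Icc a b, x₁ t = x₂ t ∧ y₁ t = y₂ t := by
  have hx₁ : ContinuousOn x₁ (Icc a b) := fun t ht => (dx₁ t ht).continuousAt.continuousWithinAt
  have hx₂ : ContinuousOn x₂ (Icc a b) := fun t ht => (dx₂ t ht).continuousAt.continuousWithinAt
  have hy₁ : ContinuousOn y₁ (Icc a b) := fun t ht => (dy₁ t ht).continuousAt.continuousWithinAt
  have hy₂ : ContinuousOn y₂ (Icc a b) := fun t ht => (dy₂ t ht).continuousAt.continuousWithinAt
  obtain ⟨C₁, hC₁⟩ := isCompact_Icc.exists_bound_of_continuousOn hx₁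
  obtain ⟨C₂, hC₂⟩ := isCompact_Icc.exists_bound_of_continuousOn hx₂
  obtain ⟨K, hK⟩ := lipschitzOnWith_oscField h (max C₁ C₂)
  have := ODE_solution_unique_of_mem_Icc_left (v := fun _ => oscField m k c p)
    (s := fun _ => {z | z.1 ≤ max C₁ C₂}) (f := fun t => (x₁ t, y₁ t)) (g := fun t => (x₂ t, y₂ t))
    (a := a) (b := b) (fun _ _ => hK) (hx₁.prodMk hy₁)
    (fun t ht => ((dx₁ t (Ioc_subset_Icc_self ht)).prodMk
      (dy₁ t (Ioc_subset_Icc_self ht))).hasDerivWithinAt)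
    (fun t ht => (le_abs_self _).trans ((hC₁ t (Ioc_subset_Icc_self ht)).trans (le_max_left _ _)))
    (hx₂.prodMk hy₂)
    (fun t ht => ((dx₂ t (Ioc_subset_Icc_self ht)).prodMk
      (dy₂ t (Ioc_subset_Icc_self ht))).hasDerivWithinAt)
    (fun t ht => (le_abs_self _).trans ((hC₂ t (Ioc_subset_Icc_self ht)).trans (le_max_right _ _)))
    (by simp [ex, ey])
  intro t ht
  simpa using this ht

/-! ### Global existence -/

/-- A bounded Lipschitz vector field has global integral curves. -/
lemma exists_integralCurve_of_bounded {E : Type*} [NormedAddCommGroup E] [NormedSpace ℝ E]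
    [CompleteSpace E] {v : E → E} {K L : NNReal} (hK : LipschitzWith K v) (hL : ∀ z, ‖v z‖ ≤ L)
    (z₀ : E) : ∃ f : ℝ → E, f 0 = z₀ ∧ ∀ t, HasDerivAt f (v (f t)) t := by
  have hloc : ∀ n : ℕ, ∃ f : ℝ → E, f 0 = z₀ ∧
      ∀ t ∈ Ioo (-((n : ℝ) + 1)) ((n : ℝ) + 1), HasDerivAt f (v (f t)) t := by
    intro n
    have hn : (0 : ℝ) ≤ (n : ℝ) + 1 := by positivity
    have hpl : IsPicardLindelof (fun _ : ℝ => v) (tmin := -((n : ℝ) + 1)) (tmax := (n : ℝ) + 1)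
        ⟨0, by constructor <;> linarith⟩ z₀ (L * (n + 1)) 0 L K := by
      refine IsPicardLindelof.of_time_independent (fun z _ => hL z) hK.lipschitzOnWith ?_
      simp
    obtain ⟨f, hf0, hf⟩ := hpl.exists_eq_forall_mem_Icc_hasDerivWithinAt₀
    exact ⟨f, hf0, fun t ht => (hf t (Ioo_subset_Icc_self ht)).hasDerivAt (Icc_mem_nhds ht.1 ht.2)⟩
  choose f hf0 hf using hloc
  have hagree : ∀ i j : ℕ, i ≤ j → EqOn (f i) (f j) (Ioo (-((i : ℝ) + 1)) ((i : ℝ) + 1)) := by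
    intro i j hij
    have hi : (0 : ℝ) < (i : ℝ) + 1 := by positivity
    have hij' : (i : ℝ) ≤ j := by exact_mod_cast hij
    refine ODE_solution_unique_of_mem_Ioo (v := fun _ => v) (s := fun _ => univ) (t₀ := 0)
      (fun _ _ => hK.lipschitzOnWith) ⟨by linarith, hi⟩ (fun t ht => ⟨hf i t ht, mem_univ _⟩)
      (fun t ht => ⟨hf j t ⟨by linarith [ht.1], by linarith [ht.2]⟩, mem_univ _⟩)
      (by rw [hf0, hf0])
  have hidx : ∀ t : ℝ, t ∈ Ioo (-(((⌈|t|⌉₊ : ℕ) : ℝ) + 1)) (((⌈|t|⌉₊ : ℕ) : ℝ) + 1) := by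
    intro t
    have := Nat.le_ceil |t|
    constructor <;> linarith [neg_abs_le t, le_abs_self t]
  refine ⟨fun t => f ⌈|t|⌉₊ t, by simp [hf0], fun t => ?_⟩
  have hev : (fun s => f ⌈|s|⌉₊ s) =ᶠ[𝓝 t] f ⌈|t|⌉₊ := by
    filter_upwards [Ioo_mem_nhds (hidx t).1 (hidx t).2] with s hs
    rcases le_total ⌈|s|⌉₊ ⌈|t|⌉₊ with hle | hle
    · exact hagree _ _ hle (hidx s)
    · exact (hagree _ _ hle hs).symm
  exact (hf _ t (hidx t)).congr_of_eventuallyEq hev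

end

section
variable {m k c p : ℝ}

lemma hasDerivAt_energy (h : Admissible m k c p) {x y : ℝ → ℝ} {t : ℝ}
    (hx : HasDerivAt x (y t) t) (hy : HasDerivAt y (-(k - m) * y t - force m k c p (x t)) t) :
    HasDerivAt (fun t => energy m k c p (x t) (y t)) (-(k - m) * y t ^ 2) t := by
  have h1 := (hasDerivAt_potential h (x t)).comp t hx
  refine (((hy.pow 2).div_const 2).add h1).congr_deriv ?_
  simp; ring

/-- From every initial slope starts a trajectory. -/
theorem exists_isTrajectory (h : Admissible m k c p) (α : ℝ) :
    ∃ x y : ℝ → ℝ, IsTrajectory m k c p α x y := by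
  obtain ⟨M, hM0, hM⟩ := exists_lt_potential h (α ^ 2 / 2)
  obtain ⟨B, hB0, hB⟩ := exists_le_potential h
  -- Energy at most α²/2 and V ≥ -B give y² ≤ α² + 2B < R², while V > α²/2 beyond M. The field is
  -- clipped to x ≤ M, |y| ≤ R, and the energy shows that the clipping never acts.
  set R : ℝ := |α| + B + 2 with hR
  have hR0 : 0 < R := by positivity
  have hRsq : α ^ 2 + 2 * B < R ^ 2 := by
    rw [← sq_abs α, hR]; nlinarith [abs_nonneg α, mul_nonneg (abs_nonneg α) hB0]
  obtain ⟨K, hK⟩ := lipschitzOnWith_force h M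
  have hclip : LipschitzWith 1 (fun y : ℝ => max (min y R) (-R)) :=
    (LipschitzWith.id.min_const R).max_const (-R)
  have hclipR : ∀ y : ℝ, |max (min y R) (-R)| ≤ R := fun y =>
    abs_le.2 ⟨le_max_right _ _, max_le (min_le_right _ _) (by linarith)⟩
  have hforce : LipschitzWith (K * 1) (fun x : ℝ => force m k c p (min x M)) := by
    rw [← lipschitzOnWith_univ]
    exact hK.comp (LipschitzWith.id.min_const M).lipschitzOnWith (fun x _ => min_le_right x M)
  obtain ⟨C, hC⟩ := isCompact_Icc.exists_bound_of_continuousOn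
    (continuous_force h).continuousOn (s := Icc 0 M)
  have hC0 : 0 ≤ C := (norm_nonneg _).trans (hC 0 ⟨le_rfl, hM0.le⟩)
  have hCb : ∀ x, |force m k c p (min x M)| ≤ C := by
    intro x
    rcases le_total (min x M) 0 with hx | hx
    · rw [force_of_nonpos h hx]; simpa
    · exact hC _ ⟨hx, min_le_right _ _⟩
  set v : ℝ × ℝ → ℝ × ℝ := fun z =>
    (max (min z.2 R) (-R), -(k - m) * max (min z.2 R) (-R) - force m k c p (min z.1 M)) with hv
  have hvK : ∃ K', LipschitzWith K' v := by
    have h1 := hclip.comp (LipschitzWith.prod_snd (α := ℝ) (β := ℝ))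
    have h2 := (lipschitzWith_smul (-(k - m))).comp h1
    have h3 := hforce.comp (LipschitzWith.prod_fst (α := ℝ) (β := ℝ))
    exact ⟨_, h1.prodMk (h2.sub h3)⟩
  obtain ⟨K', hK'⟩ := hvK
  have hvL : ∀ z, ‖v z‖ ≤ ((R + ((k - m) * R + C)).toNNReal : ℝ) := by
    intro z
    have hd := h.damping_pos
    rw [Real.coe_toNNReal _ (by positivity)]
    have h1 := hclipR z.2
    have h2 := hCb z.1
    have h3 : |-(k - m) * max (min z.2 R) (-R)| ≤ (k - m) * R := by
      rw [abs_mul, abs_neg, abs_of_pos hd]; gcongr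
    refine norm_prod_le_iff.2 ⟨?_, ?_⟩
    · rw [Real.norm_eq_abs]
      refine h1.trans ?_
      have : 0 ≤ (k - m) * R := by positivity
      linarith
    · rw [Real.norm_eq_abs]
      refine (abs_sub _ _).trans ?_
      linarith
  obtain ⟨f, hf0, hf⟩ := exists_integralCurve_of_bounded hK' hvL (0, α)
  set x : ℝ → ℝ := fun t => (f t).1 with hx
  set y : ℝ → ℝ := fun t => (f t).2 with hy
  have x0 : x 0 = 0 := by simp [hx, hf0]
  have y0 : y 0 = α := by simp [hy, hf0]
  have dx : ∀ t, HasDerivAt x (max (min (y t) R) (-R)) t := fun t => (hf t).fst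
  have dy : ∀ t, HasDerivAt y
      (-(k - m) * max (min (y t) R) (-R) - force m k c p (min (x t) M)) t := fun t => (hf t).snd
  have hxc : Continuous x := continuous_iff_continuousAt.2 fun t => (dx t).continuousAt
  have hyc : Continuous y := continuous_iff_continuousAt.2 fun t => (dy t).continuousAt
  have hunclip : ∀ t, x t ≤ M → -R ≤ y t → y t ≤ R → HasDerivAt x (y t) t ∧
      HasDerivAt y (-(k - m) * y t - force m k c p (x t)) t := by
    intro t h1 h2 h3
    have e1 := dx t
    have e2 := dy t
    rw [min_eq_left h3, max_eq_left h2] at e1 e2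
    rw [min_eq_left h1] at e2
    exact ⟨e1, e2⟩
  -- Positive exactly in the open box. Up to a first zero of φ the true equation holds, so the
  -- energy has not grown, which keeps the trajectory strictly inside.
  set φ : ℝ → ℝ := fun t => min (M - x t) (min (R - y t) (R + y t)) with hφ
  have hφc : Continuous φ := by fun_prop
  have hφpos : ∀ t, 0 ≤ t → 0 < φ t := by
    intro t ht
    by_contra hcon
    have hφ0 : 0 < φ 0 := by
      simp only [hφ, x0, y0, lt_min_iff]
      refine ⟨by linarith, ?_, ?_⟩ <;> linarith [le_abs_self α, neg_abs_le α]
    obtain ⟨s, hs0, -, hs, hlt⟩ := exists_first_nonpos hφc.continuousOn ht hφ0 (not_lt.1 hcon)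
    have hin : ∀ τ ∈ Icc 0 s, x τ ≤ M ∧ -R ≤ y τ ∧ y τ ≤ R := by
      intro τ hτ
      have : 0 ≤ φ τ := by
        rcases hτ.2.lt_or_eq with h1 | h1
        · exact (hlt τ hτ.1 h1).le
        · rw [h1, hs]
      simp only [hφ, le_min_iff] at this
      refine ⟨?_, ?_, ?_⟩ <;> linarith [this.1, this.2.1, this.2.2]
    have hanti : AntitoneOn (fun t => energy m k c p (x t) (y t)) (Icc 0 s) :=
      antitoneOn_of_hasDerivAt_nonpos (convex_Icc 0 s)
        (fun τ hτ => by
          obtain ⟨a1, a2, a3⟩ := hin τ hτ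
          obtain ⟨e1, e2⟩ := hunclip τ a1 a2 a3
          exact hasDerivAt_energy h e1 e2)
        (fun τ _ => by nlinarith [h.damping_pos, sq_nonneg (y τ)])
    have hE := hanti ⟨le_rfl, hs0.le⟩ ⟨hs0.le, le_rfl⟩ hs0.le
    simp only [energy, x0, y0, potential_of_nonpos h le_rfl, add_zero] at hE
    have hx1 : x s < M := by
      by_contra hx1
      have := hM _ (not_lt.1 hx1)
      nlinarith [sq_nonneg (y s)]
    have hy1 : |y s| < R := by
      apply abs_lt_of_sq_lt_sq _ hR0.le
      linarith [hB (x s)]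
    have : 0 < φ s := by
      simp only [hφ, lt_min_iff]
      obtain ⟨b1, b2⟩ := abs_lt.1 hy1
      refine ⟨?_, ?_, ?_⟩ <;> linarith
    linarith
  have hfin : ∀ t, 0 ≤ t → HasDerivAt x (y t) t ∧
      HasDerivAt y (-(k - m) * y t - force m k c p (x t)) t := by
    intro t ht
    have := hφpos t ht
    simp only [hφ, lt_min_iff] at this
    exact hunclip t (by linarith) (by linarith) (by linarith)
  exact ⟨x, y, x0, y0, fun t ht => (hfin t ht).1, fun t ht => (hfin t ht).2⟩

/-! ### Trajectories: a priori bounds, continuous dependence, first zero. -/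

namespace IsTrajectory
variable {α : ℝ} {x y : ℝ → ℝ}

lemma continuousOn_x (T : IsTrajectory m k c p α x y) : ContinuousOn x (Ici 0) :=
  fun t ht => (T.deriv_x t ht).continuousAt.continuousWithinAt

lemma continuousOn_y (T : IsTrajectory m k c p α x y) : ContinuousOn y (Ici 0) :=
  fun t ht => (T.deriv_y t ht).continuousAt.continuousWithinAt

lemma hasDerivAt_energy (h : Admissible m k c p) (T : IsTrajectory m k c p α x y) {t : ℝ}
    (ht : 0 ≤ t) :
    HasDerivAt (fun t => energy m k c p (x t) (y t)) (-(k - m) * y t ^ 2) t :=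
  _root_.hasDerivAt_energy h (T.deriv_x t ht) (T.deriv_y t ht)

lemma antitoneOn_energy (h : Admissible m k c p) (T : IsTrajectory m k c p α x y) :
    AntitoneOn (fun t => energy m k c p (x t) (y t)) (Ici 0) :=
  antitoneOn_of_hasDerivAt_nonpos (convex_Ici 0) (fun _ ht => T.hasDerivAt_energy h ht)
    (fun t _ => by nlinarith [h.damping_pos, sq_nonneg (y t)])

lemma energy_zero (h : Admissible m k c p) (T : IsTrajectory m k c p α x y) :
    energy m k c p (x 0) (y 0) = α ^ 2 / 2 := by
  simp [energy, T.x_zero, T.y_zero, potential_of_nonpos h le_rfl]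

lemma energy_le (h : Admissible m k c p) (T : IsTrajectory m k c p α x y) {t : ℝ} (ht : 0 ≤ t) :
    energy m k c p (x t) (y t) ≤ α ^ 2 / 2 := by
  rw [← T.energy_zero h]
  exact T.antitoneOn_energy h (mem_Ici.2 le_rfl) ht ht

/-- Trajectories are bounded above, uniformly for bounded initial slopes. -/
lemma exists_le (h : Admissible m k c p) (A : ℝ) :
    ∃ M, 0 < M ∧ ∀ α, |α| ≤ A → ∀ x y, IsTrajectory m k c p α x y → ∀ t, 0 ≤ t → x t ≤ M := by
  obtain ⟨M, hM0, hM⟩ := exists_lt_potential h (A ^ 2 / 2)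
  refine ⟨M, hM0, fun α hα x y T t ht => ?_⟩
  by_contra hcon
  have h1 := hM _ (not_le.1 hcon).le
  have h2 := T.energy_le h ht
  have h3 : α ^ 2 ≤ A ^ 2 := sq_le_sq' (abs_le.1 hα).1 (abs_le.1 hα).2
  unfold energy at h2
  nlinarith [sq_nonneg (y t)]

lemma exists_abs_y_le (h : Admissible m k c p) (T : IsTrajectory m k c p α x y) :
    ∃ M, 0 < M ∧ ∀ t, 0 ≤ t → |y t| ≤ M := by
  obtain ⟨B, hB0, hB⟩ := exists_le_potential h
  refine ⟨|α| + B + 2, by positivity, fun t ht => ?_⟩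
  apply abs_le_of_sq_le_sq _ (by positivity)
  have h1 := T.energy_le h ht
  have h2 := hB (x t)
  unfold energy at h1
  rw [← sq_abs α] at h1
  nlinarith [abs_nonneg α, mul_nonneg (abs_nonneg α) hB0]

/-- Trajectories depend continuously on the initial slope. -/
lemma dist_lt_of_near (h : Admissible m k c p) (T : IsTrajectory m k c p α x y) {t ε : ℝ}
    (ht : 0 ≤ t) (hε : 0 < ε) :
    ∃ δ, 0 < δ ∧ ∀ β, |β - α| < δ → ∀ x' y', IsTrajectory m k c p β x' y' →
      |x' t - x t| < ε ∧ |y' t - y t| < ε := by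
  obtain ⟨M, -, hM⟩ := exists_le h (|α| + 1)
  obtain ⟨K, hK⟩ := lipschitzOnWith_oscField h M
  -- The 1 keeps all competing slopes below |α| + 1, where the bound M is uniform; the other entry
  -- compensates the Grönwall factor.
  refine ⟨min 1 (ε / 2 * Real.exp (-(K * t))), by positivity, fun β hβ x' y' T' => ?_⟩
  have hβ1 : |β| ≤ |α| + 1 := by
    have := abs_sub_abs_le_abs_sub β α
    linarith [hβ.le.trans (min_le_left _ _)]
  have key := dist_le_of_trajectories_ODE_of_mem (v := fun _ => oscField m k c p)
    (s := fun _ => {z | z.1 ≤ M}) (f := fun t => (x' t, y' t)) (g := fun t => (x t, y t))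
    (a := 0) (b := t) (δ := |β - α|) (fun _ _ => hK)
    ((T'.continuousOn_x.prodMk T'.continuousOn_y).mono Icc_subset_Ici_self)
    (fun s hs => ((T'.deriv_x s hs.1).prodMk (T'.deriv_y s hs.1)).hasDerivWithinAt)
    (fun s hs => hM β hβ1 x' y' T' s hs.1)
    ((T.continuousOn_x.prodMk T.continuousOn_y).mono Icc_subset_Ici_self)
    (fun s hs => ((T.deriv_x s hs.1).prodMk (T.deriv_y s hs.1)).hasDerivWithinAt)
    (fun s hs => hM α (by linarith) x y T s hs.1)
    (by simp [Prod.dist_eq, T.x_zero, T.y_zero, T'.x_zero, T'.y_zero, Real.dist_eq])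
    t ⟨ht, le_rfl⟩
  have hlt : |β - α| * Real.exp (K * (t - 0)) < ε := by
    have h1 := hβ.trans_le (min_le_right _ _)
    have h2 : |β - α| * Real.exp (K * t) ≤ ε / 2 * Real.exp (-(K * t)) * Real.exp (K * t) := by
      gcongr
    rw [mul_assoc, ← Real.exp_add, neg_add_cancel, Real.exp_zero, mul_one] at h2
    rw [sub_zero]; linarith
  have := key.trans_lt hlt
  rw [Prod.dist_eq, max_lt_iff] at this
  simpa [Real.dist_eq] using this

/-- Two trajectories with the same initial slope coincide. -/
lemma unique (h : Admissible m k c p) (T : IsTrajectory m k c p α x y) {x' y' : ℝ → ℝ}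
    (T' : IsTrajectory m k c p α x' y') {t : ℝ} (ht : 0 ≤ t) : x t = x' t ∧ y t = y' t :=
  oscillator_unique_right h (a := 0) (b := t) (T.continuousOn_x.mono Icc_subset_Ici_self)
    (T.continuousOn_y.mono Icc_subset_Ici_self) (T'.continuousOn_x.mono Icc_subset_Ici_self)
    (T'.continuousOn_y.mono Icc_subset_Ici_self)
    (fun s hs => (T.deriv_x s hs.1).hasDerivWithinAt)
    (fun s hs => (T.deriv_y s hs.1).hasDerivWithinAt)
    (fun s hs => (T'.deriv_x s hs.1).hasDerivWithinAt)
    (fun s hs => (T'.deriv_y s hs.1).hasDerivWithinAt)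
    (by rw [T.x_zero, T'.x_zero]) (by rw [T.y_zero, T'.y_zero]) t ⟨ht, le_rfl⟩

/-- A trajectory with nonzero initial slope never reaches the equilibrium `(0, 0)`. -/
lemma y_ne_zero_of_x_eq_zero (h : Admissible m k c p) (T : IsTrajectory m k c p α x y)
    (hα : α ≠ 0) {t : ℝ} (ht : 0 ≤ t) (hx : x t = 0) : y t ≠ 0 := by
  intro hy
  have := oscillator_unique_left h (a := 0) (b := t) (x₂ := fun _ => 0) (y₂ := fun _ => 0)
    (fun s hs => T.deriv_x s hs.1) (fun s hs => T.deriv_y s hs.1)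
    (fun s _ => hasDerivAt_const s 0)
    (fun s _ => (hasDerivAt_const s 0).congr_deriv (by simp [force_of_nonpos h le_rfl]))
    hx hy 0 ⟨le_rfl, ht⟩
  exact hα (T.y_zero ▸ this.2)

/-- After its first return to `x = 0` a trajectory stays in `x < 0`. -/
lemma neg_after_zero (h : Admissible m k c p) (T : IsTrajectory m k c p α x y) {s : ℝ}
    (hs : 0 ≤ s) (hx : x s = 0) (hy : y s < 0) {t : ℝ} (hst : s < t) :
    x t < 0 ∧ y t < 0 := by
  have hd := h.damping_pos
  -- For x ≤ 0 there is no force, so the equation is y' = -(k-m) y. Its explicit solution stays in x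
  -- ≤ 0, and uniqueness identifies it with the trajectory.
  have hX : ∀ τ, HasDerivAt (fun τ => y s / (k - m) * (1 - Real.exp (-(k - m) * (τ - s))))
      (y s * Real.exp (-(k - m) * (τ - s))) τ := by
    intro τ
    have h1 : HasDerivAt (fun τ => -(k - m) * (τ - s)) (-(k - m)) τ := by
      simpa using ((hasDerivAt_id τ).sub_const s).const_mul (-(k - m))
    refine ((h1.exp.const_sub 1).const_mul (y s / (k - m))).congr_deriv ?_
    field_simp
  have hY : ∀ τ, s ≤ τ → HasDerivAt (fun τ => y s * Real.exp (-(k - m) * (τ - s)))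
      (-(k - m) * (y s * Real.exp (-(k - m) * (τ - s))) -
        force m k c p (y s / (k - m) * (1 - Real.exp (-(k - m) * (τ - s))))) τ := by
    intro τ hτ
    have h1 : HasDerivAt (fun τ => -(k - m) * (τ - s)) (-(k - m)) τ := by
      simpa using ((hasDerivAt_id τ).sub_const s).const_mul (-(k - m))
    refine (h1.exp.const_mul (y s)).congr_deriv ?_
    rw [force_of_nonpos h, sub_zero]
    · ring
    · apply mul_nonpos_of_nonpos_of_nonneg (div_nonpos_of_nonpos_of_nonneg hy.le hd.le)
      rw [sub_nonneg, Real.exp_le_one_iff]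
      nlinarith
  have hsub : Icc s t ⊆ Ici 0 := fun τ hτ => hs.trans hτ.1
  have key := oscillator_unique_right h (T.continuousOn_x.mono hsub) (T.continuousOn_y.mono hsub)
    (fun τ _ => (hX τ).continuousAt.continuousWithinAt)
    (fun τ hτ => (hY τ hτ.1).continuousAt.continuousWithinAt)
    (fun τ hτ => (T.deriv_x τ (hs.trans hτ.1)).hasDerivWithinAt)
    (fun τ hτ => (T.deriv_y τ (hs.trans hτ.1)).hasDerivWithinAt)
    (fun τ _ => (hX τ).hasDerivWithinAt)
    (fun τ hτ => (hY τ hτ.1).hasDerivWithinAt) (by simp [hx]) (by simp) t ⟨hst.le, le_rfl⟩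
  rw [key.1, key.2]
  refine ⟨?_, mul_neg_of_neg_of_pos hy (Real.exp_pos _)⟩
  apply mul_neg_of_neg_of_pos (div_neg_of_neg_of_pos hy hd)
  rw [sub_pos, Real.exp_lt_one_iff]
  nlinarith

/-- Right after the start the trajectory is positive. -/
lemma eventually_pos (T : IsTrajectory m k c p α x y) (hα : 0 < α) :
    ∃ δ, 0 < δ ∧ ∀ t, 0 < t → t ≤ δ → 0 < x t ∧ 0 < y t := by
  have h1 : ∀ᶠ t in 𝓝 (0:ℝ), 0 < y t :=
    (T.deriv_y 0 le_rfl).continuousAt.eventually (lt_mem_nhds (by rw [T.y_zero]; exact hα))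
  obtain ⟨δ, hδ, hb⟩ := Metric.eventually_nhds_iff.1 h1
  have hpos : ∀ t ∈ Icc 0 (δ / 2), 0 < y t := fun t ht => hb (by
    rw [Real.dist_eq, sub_zero, abs_of_nonneg ht.1]; linarith [ht.2])
  have hmono := strictMonoOn_of_hasDerivAt_pos (convex_Icc 0 (δ / 2))
    (fun t ht => T.deriv_x t ht.1) hpos
  refine ⟨δ / 2, by positivity, fun t h0 h2 => ⟨?_, hpos t ⟨h0.le, h2⟩⟩⟩
  have := hmono ⟨le_rfl, by positivity⟩ ⟨h0.le, h2⟩ h0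
  rwa [T.x_zero] at this

/-- Either the trajectory stays positive, or it has a first zero, at which it crosses. -/
lemma pos_or_crosses (h : Admissible m k c p) (T : IsTrajectory m k c p α x y) (hα : 0 < α) :
    (∀ t, 0 < t → 0 < x t) ∨
      ∃ s, 0 < s ∧ x s = 0 ∧ y s < 0 ∧ (∀ t, 0 < t → t < s → 0 < x t) ∧ ∀ t, s < t → x t < 0 := by
  rw [or_iff_not_imp_left]
  intro hn
  push Not at hn
  obtain ⟨b, hb0, hb⟩ := hn
  obtain ⟨δ, hδ, hpos⟩ := T.eventually_pos hα
  have hδb : δ ≤ b := by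
    by_contra hcon
    exact absurd (hpos b hb0 (not_le.1 hcon).le).1 (not_lt.2 hb)
  obtain ⟨s, hs1, -, hs, hlt⟩ := exists_first_nonpos
    (T.continuousOn_x.mono (fun t ht => hδ.le.trans ht.1)) hδb (hpos δ hδ le_rfl).1 hb
  have hs0 : 0 < s := hδ.trans hs1
  have hall : ∀ t, 0 < t → t < s → 0 < x t := by
    intro t h1 h2
    rcases le_total t δ with h3 | h3
    · exact (hpos t h1 h3).1
    · exact hlt t h3 h2
  have hy : y s < 0 := by
    refine lt_of_le_of_ne ?_ (T.y_ne_zero_of_x_eq_zero h hα.ne' hs0.le hs)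
    -- Difference quotients from the left at a first zero are nonpositive.
    have hslope := (T.deriv_x s hs0.le).hasDerivWithinAt (s := Iio s)
    rw [hasDerivWithinAt_iff_tendsto_slope' (by simp)] at hslope
    refine le_of_tendsto hslope ?_
    filter_upwards [Ioo_mem_nhdsLT hs0] with t ht
    rw [slope_def_field, hs]
    exact div_nonpos_of_nonneg_of_nonpos (by linarith [hall t ht.1 ht.2]) (by linarith [ht.2])
  exact ⟨s, hs0, hs, hy, hall, fun t ht => (T.neg_after_zero h hs0.le hs hy ht).1⟩

end IsTrajectory
end

/-! ### Asymptotics of positive trajectories. -/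

section
variable {m k c p : ℝ}

lemma abs_sub_le_of_hasDerivAt {f f' : ℝ → ℝ} {C : ℝ} (hf : ∀ t, 0 ≤ t → HasDerivAt f (f' t) t)
    (hC : ∀ t, 0 ≤ t → |f' t| ≤ C) {s t : ℝ} (hs : 0 ≤ s) (hst : s ≤ t) :
    |f t - f s| ≤ C * (t - s) := by
  have := (convex_Ici (0:ℝ)).norm_image_sub_le_of_norm_hasDerivWithin_le
    (f := f) (f' := f') (C := C) (fun t ht => (hf t ht).hasDerivWithinAt) (fun t ht => hC t ht)
    (mem_Ici.2 hs) (mem_Ici.2 (hs.trans hst))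
  rwa [Real.norm_eq_abs, Real.norm_eq_abs, abs_of_nonneg (sub_nonneg.2 hst)] at this

lemma exists_abs_force_le (h : Admissible m k c p) (M : ℝ) :
    ∃ C, 0 ≤ C ∧ ∀ x, x ≤ M → |force m k c p x| ≤ C := by
  obtain ⟨C, hC⟩ := isCompact_Icc.exists_bound_of_continuousOn
    (continuous_force h).continuousOn (s := Icc 0 M)
  refine ⟨max C 0, le_max_right _ _, fun x hx => ?_⟩
  rcases le_total x 0 with h0 | h0
  · rw [force_of_nonpos h h0]; simp
  · exact (hC x ⟨h0, hx⟩).trans (le_max_left _ _)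

namespace IsTrajectory
variable {α : ℝ} {x y : ℝ → ℝ}

/-- Along every trajectory the velocity and the force tend to `0`. -/
lemma tendsto_y_force (h : Admissible m k c p) (T : IsTrajectory m k c p α x y) :
    Tendsto y atTop (𝓝 0) ∧ Tendsto (fun t => force m k c p (x t)) atTop (𝓝 0) := by
  have hd := h.damping_pos
  obtain ⟨M, hM0, hM'⟩ := exists_le h |α|
  have hM := hM' α le_rfl x y T
  obtain ⟨Y, hY0, hY⟩ := T.exists_abs_y_le h
  obtain ⟨C, hC0, hC⟩ := exists_abs_force_le h M
  obtain ⟨K, hK⟩ := lipschitzOnWith_force h M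
  have hdy : ∀ t, 0 ≤ t → |-(k - m) * y t - force m k c p (x t)| ≤ (k - m) * Y + C := by
    intro t ht
    refine (abs_sub _ _).trans (add_le_add ?_ (hC _ (hM t ht)))
    rw [abs_mul, abs_neg, abs_of_pos hd]
    exact mul_le_mul_of_nonneg_left (hY t ht) hd.le
  have hyL : ∀ s t, 0 ≤ s → s ≤ t → |y t - y s| ≤ ((k - m) * Y + C) * (t - s) :=
    fun s t hs hst => abs_sub_le_of_hasDerivAt T.deriv_y hdy hs hst
  have hxL : ∀ s t, 0 ≤ s → s ≤ t → |x t - x s| ≤ Y * (t - s) :=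
    fun s t hs hst => abs_sub_le_of_hasDerivAt T.deriv_x hY hs hst
  have hfL : ∀ s t, 0 ≤ s → s ≤ t →
      |force m k c p (x t) - force m k c p (x s)| ≤ K * Y * (t - s) := by
    intro s t hs hst
    have h1 := hK.dist_le_mul (x t) (hM t (hs.trans hst)) (x s) (hM s hs)
    rw [Real.dist_eq, Real.dist_eq] at h1
    rw [mul_assoc]
    exact h1.trans (mul_le_mul_of_nonneg_left (hxL s t hs hst) K.2)
  obtain ⟨B, -, hB⟩ := exists_le_potential h
  -- The energy converges and its derivative -(k-m) y² is Lipschitz in time, so y → 0.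
  obtain ⟨L, hL, -⟩ := exists_tendsto_of_antitoneOn_Ici (T.antitoneOn_energy h) (B := -B)
    (fun t _ => by have := hB (x t); unfold energy; nlinarith [sq_nonneg (y t)])
  have hE := tendsto_deriv_zero_of_tendsto hL (fun t ht => T.hasDerivAt_energy h ht)
    (K := (k - m) * (2 * Y) * ((k - m) * Y + C)) (fun s t hs hst => by
      have e : -(k - m) * y t ^ 2 - -(k - m) * y s ^ 2 =
          -(k - m) * ((y t + y s) * (y t - y s)) := by ring
      rw [e, abs_mul, abs_mul, abs_neg, abs_of_pos hd, mul_assoc (k - m), mul_assoc (k - m),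
        mul_assoc (2 * Y)]
      have h1 : |y t + y s| ≤ 2 * Y :=
        (abs_add_le _ _).trans (by linarith [hY t (hs.trans hst), hY s hs])
      have h2 := hyL s t hs hst
      gcongr)
  have hy2 : Tendsto (fun t => y t ^ 2) atTop (𝓝 0) := by
    have := hE.const_mul (-(k - m))⁻¹
    rw [mul_zero] at this
    refine this.congr fun t => ?_
    have : k - m ≠ 0 := hd.ne'
    field_simp
  have hy : Tendsto y atTop (𝓝 0) := by
    have := (Real.continuous_sqrt.tendsto 0).comp hy2
    rw [Real.sqrt_zero] at this
    refine (tendsto_zero_iff_abs_tendsto_zero y).2 (this.congr fun t => ?_)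
    simp [Real.sqrt_sq_eq_abs]
  refine ⟨hy, ?_⟩
  -- The same argument one level up: y' → 0, and the force is -(k-m) y - y'.
  have hy' := tendsto_deriv_zero_of_tendsto hy T.deriv_y
    (K := (k - m) * ((k - m) * Y + C) + K * Y) (fun s t hs hst => by
      have e : -(k - m) * y t - force m k c p (x t) - (-(k - m) * y s - force m k c p (x s)) =
          -(k - m) * (y t - y s) - (force m k c p (x t) - force m k c p (x s)) := by ring
      rw [e]
      refine (abs_sub _ _).trans ?_
      rw [abs_mul, abs_neg, abs_of_pos hd, add_mul, mul_assoc (k - m)]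
      exact add_le_add (mul_le_mul_of_nonneg_left (hyL s t hs hst) hd.le) (hfL s t hs hst))
  have := (hy.const_mul (-(k - m))).sub hy'
  simp only [mul_zero, sub_zero] at this
  refine this.congr fun t => by ring

lemma tendsto_mul_force (h : Admissible m k c p) (T : IsTrajectory m k c p α x y)
    (hx : ∀ t, 0 < t → 0 < x t) :
    Tendsto (fun t => x t * force m k c p (x t)) atTop (𝓝 0) := by
  obtain ⟨M, hM0, hM'⟩ := exists_le h |α|
  have hM := hM' α le_rfl x y T
  refine (T.tendsto_y_force h).2.zero_mul_isBoundedUnder_le ?_ |>.congr fun t => mul_comm _ _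
  refine isBoundedUnder_of_eventually_le (a := M) ?_
  filter_upwards [eventually_gt_atTop 0] with t ht
  simp only [Function.comp, Real.norm_eq_abs]
  rw [abs_of_pos (hx t ht)]
  exact hM t ht.le

/-- A positive trajectory of nonnegative energy tends to the origin. -/
lemma tendsto_x_zero (h : Admissible m k c p) (T : IsTrajectory m k c p α x y)
    (hx : ∀ t, 0 < t → 0 < x t) (hE : ∀ t, 0 < t → 0 ≤ energy m k c p (x t) (y t)) :
    Tendsto x atTop (𝓝 0) := by
  have hp := h.one_lt_p
  have hmk := mul_pos h.m_pos h.k_pos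
  set q := m * k * (p - 1) / (2 * (p + 1)) with hq
  have hq0 : 0 < q := div_pos (mul_pos hmk (by linarith)) (by linarith)
  have h1 : Tendsto (fun t => (x t * force m k c p (x t) / (p + 1) + y t ^ 2 / 2) / q) atTop
      (𝓝 0) := by
    have := (((T.tendsto_mul_force h hx).div_const (p + 1)).add
      (((T.tendsto_y_force h).1.pow 2).div_const 2)).div_const q
    simpa using this
  -- By `potential_eq`, nonnegative energy reads q x² ≤ x f(x)/(p+1) + y²/2, whose right side tends
  -- to 0.
  have h2 : Tendsto (fun t => x t ^ 2) atTop (𝓝 0) := by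
    refine tendsto_of_tendsto_of_tendsto_of_le_of_le' tendsto_const_nhds h1
      (Eventually.of_forall fun t => sq_nonneg _) ?_
    filter_upwards [eventually_gt_atTop 0] with t ht
    rw [le_div_iff₀ hq0]
    have := hE t ht
    rw [energy, potential_eq h (hx t ht).le, ← hq] at this
    linarith
  have := (Real.continuous_sqrt.tendsto 0).comp h2
  rw [Real.sqrt_zero] at this
  refine this.congr' ?_
  filter_upwards [eventually_gt_atTop 0] with t ht
  simp [Real.sqrt_sq (hx t ht).le]

/-- A positive trajectory that reaches negative energy tends to the nontrivial equilibrium. -/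
lemma tendsto_x_equilibrium (h : Admissible m k c p) (T : IsTrajectory m k c p α x y)
    (hx : ∀ t, 0 < t → 0 < x t) {t₀ : ℝ} (ht₀ : 0 ≤ t₀)
    (hE : energy m k c p (x t₀) (y t₀) < 0) :
    Tendsto x atTop (𝓝 ((m * k / c) ^ (1 / (p - 1)))) := by
  have hp := h.one_lt_p
  have hc := h.c_pos
  have hmk := mul_pos h.m_pos h.k_pos
  set q := m * k * (p - 1) / (2 * (p + 1)) with hq
  have hq0 : 0 < q := div_pos (mul_pos hmk (by linarith)) (by linarith)
  set e := -energy m k c p (x t₀) (y t₀) with he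
  have he0 : 0 < e := by linarith
  set r := Real.sqrt (e / (2 * q)) with hr
  have hr0 : 0 < r := Real.sqrt_pos.2 (by positivity)
  -- Energy at most -e gives q x² ≥ e + x f(x)/(p+1), which is eventually at least e/2. Being away
  -- from 0, x allows force/x = c x^(p-1) - mk → 0 to be deduced.
  have hlow : ∀ᶠ t in atTop, r ≤ x t := by
    have h1 := ((T.tendsto_mul_force h hx).div_const (p + 1)).eventually
      (lt_mem_nhds (show -(e / 2) < 0 / (p + 1) by rw [zero_div]; linarith))
    filter_upwards [h1, eventually_gt_atTop t₀] with t ht ht'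
    have hxt := hx t (by linarith)
    have h2 := T.antitoneOn_energy h ht₀ (mem_Ici.2 (ht₀.trans ht'.le)) ht'.le
    simp only at h2
    rw [energy, potential_eq h hxt.le, ← hq] at h2
    apply Real.sqrt_le_iff.2 ⟨hxt.le, _⟩
    rw [div_le_iff₀ (by positivity)]
    nlinarith [sq_nonneg (y t)]
  have h3 : Tendsto (fun t => force m k c p (x t) * (x t)⁻¹) atTop (𝓝 0) := by
    refine (T.tendsto_y_force h).2.zero_mul_isBoundedUnder_le ?_
    refine isBoundedUnder_of_eventually_le (a := r⁻¹) ?_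
    filter_upwards [hlow] with t ht
    simp only [Function.comp, norm_inv, Real.norm_eq_abs]
    exact inv_anti₀ hr0 (ht.trans (le_abs_self _))
  have h4 : Tendsto (fun t => x t ^ (p - 1)) atTop (𝓝 (m * k / c)) := by
    have := (h3.add_const (m * k)).div_const c
    rw [zero_add] at this
    refine this.congr' ?_
    filter_upwards [eventually_gt_atTop 0] with t ht
    have hxt := hx t ht
    rw [force_of_nonneg hxt.le, Real.rpow_sub_one hxt.ne']
    field_simp
    ring
  have h5 := h4.rpow_const (p := 1 / (p - 1)) (Or.inl (by positivity))
  refine h5.congr' ?_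
  filter_upwards [eventually_gt_atTop 0] with t ht
  rw [← Real.rpow_mul (hx t ht).le, mul_one_div_cancel (by linarith), Real.rpow_one]

/-- The tail of a positive trajectory of nonnegative energy: it decreases, at least and at most
exponentially, and the force is negative there. -/
lemma exists_tail (h : Admissible m k c p) (T : IsTrajectory m k c p α x y)
    (hx : ∀ t, 0 < t → 0 < x t) (hE : ∀ t, 0 < t → 0 ≤ energy m k c p (x t) (y t)) :
    ∃ σ S, 0 < σ ∧ 0 < S ∧ ∀ t, S ≤ t → y t ≤ -σ * x t ∧ force m k c p (x t) < 0 := by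
  have hp := h.one_lt_p
  have hc := h.c_pos
  have hmk := mul_pos h.m_pos h.k_pos
  have hx0 := T.tendsto_x_zero h hx hE
  have hpow : Tendsto (fun t => x t ^ (p - 1)) atTop (𝓝 0) := by
    have := hx0.rpow_const (p := p - 1) (Or.inr (by linarith))
    rwa [Real.zero_rpow (by linarith)] at this
  have hev := (hpow.eventually (gt_mem_nhds (show (0:ℝ) < m * k / (4 * c) by positivity))).and
    (eventually_gt_atTop 0)
  obtain ⟨S, hS⟩ := eventually_atTop.1 hev
  have hS0 : 0 < S := (hS S le_rfl).2
  -- Near 0 the potential is below -(3/8) mk x², so nonnegative energy forces y² ≥ (3/4) mk x²; the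
  -- constant mk/2 is a safe choice.
  set σ := Real.sqrt (m * k / 2) with hσ
  have hσ0 : 0 < σ := Real.sqrt_pos.2 (by positivity)
  have hσ2 : σ ^ 2 = m * k / 2 := Real.sq_sqrt (by positivity)
  have hsmall : ∀ t, S ≤ t → c * x t ^ (p - 1) ≤ m * k / 4 := by
    intro t ht
    have := (hS t ht).1.le
    rw [le_div_iff₀ (by positivity)] at this
    linarith
  have hfac : ∀ t, S ≤ t → x t ^ p = x t ^ (p - 1) * x t := by
    intro t ht
    rw [← Real.rpow_add_one (hx t (hS0.trans_le ht)).ne']; congr 1; ring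
  have hy2 : ∀ t, S ≤ t → (σ * x t) ^ 2 ≤ y t ^ 2 := by
    intro t ht
    have hxt := hx t (hS0.trans_le ht)
    have h1 := hE t (hS0.trans_le ht)
    have h2 : x t ^ (p + 1) = x t ^ (p - 1) * x t ^ 2 := by
      rw [Real.rpow_add_one hxt.ne', hfac t ht]; ring
    rw [energy, potential_of_nonneg hxt.le, h2] at h1
    have h3 : c / (p + 1) * (x t ^ (p - 1) * x t ^ 2) ≤ m * k / 8 * x t ^ 2 := by
      rw [← mul_assoc]
      refine mul_le_mul_of_nonneg_right ?_ (sq_nonneg _)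
      rw [div_mul_eq_mul_div, div_le_iff₀ (by linarith)]
      nlinarith [hsmall t ht]
    rw [mul_pow, hσ2]
    nlinarith [sq_nonneg (x t)]
  have hyne : ∀ t, S ≤ t → y t ≠ 0 := by
    intro t ht h0
    have h1 := hy2 t ht
    have := mul_pos hσ0 (hx t (hS0.trans_le ht))
    rw [h0] at h1
    nlinarith
  -- As y has no zero on the tail, a positive value would persist and make x increase, against x →
  -- 0.
  have hyneg : ∀ t, S ≤ t → y t < 0 := by
    intro t ht
    by_contra hcon
    have hpos : 0 < y t := lt_of_le_of_ne (not_lt.1 hcon) (hyne t ht).symm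
    have hall : ∀ s, t ≤ s → 0 < y s := by
      intro s hs
      by_contra hcon'
      obtain ⟨z, hz1, -, hz, -⟩ := exists_first_nonpos
        (T.continuousOn_y.mono (fun τ hτ => (hS0.le.trans ht).trans hτ.1)) hs hpos (not_lt.1 hcon')
      exact hyne z (ht.trans hz1.le) hz
    have hmono := monotoneOn_of_hasDerivAt_nonneg (convex_Ici t)
      (fun s hs => T.deriv_x s (hS0.le.trans (ht.trans hs))) (fun s hs => (hall s hs).le)
    have : x t ≤ 0 := ge_of_tendsto hx0 (by
      filter_upwards [eventually_ge_atTop t] with s hs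
      exact hmono (mem_Ici.2 le_rfl) hs hs)
    exact absurd (hx t (hS0.trans_le ht)) (not_lt.2 this)
  refine ⟨σ, S, hσ0, hS0, fun t ht => ⟨?_, ?_⟩⟩
  · have h1 := sq_le_sq.1 (hy2 t ht)
    rw [abs_of_neg (hyneg t ht), abs_of_pos (mul_pos hσ0 (hx t (hS0.trans_le ht)))] at h1
    linarith
  · have hxt := hx t (hS0.trans_le ht)
    rw [force_of_nonneg hxt.le, hfac t ht]
    nlinarith [hsmall t ht]

/-- Lower and upper bound of `y + k x` along a positive trajectory of nonnegative energy. -/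
lemma slope_bounds (h : Admissible m k c p) (T : IsTrajectory m k c p α x y)
    (hx : ∀ t, 0 < t → 0 < x t) (hE : ∀ t, 0 < t → 0 ≤ energy m k c p (x t) (y t)) {S : ℝ}
    (hS0 : 0 < S) (hS : ∀ t, S ≤ t → y t ≤ 0) {t : ℝ} (ht : S ≤ t) :
    0 ≤ y t + k * x t ∧ y t + k * x t ≤ c / m * x t ^ p := by
  have hp := h.one_lt_p
  have hc := h.c_pos
  have hm := h.m_pos
  have hx0 := T.tendsto_x_zero h hx hE
  have hy0 := (T.tendsto_y_force h).1
  have hexp : Tendsto (fun t : ℝ => Real.exp (-m * t)) atTop (𝓝 0) := by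
    refine Real.tendsto_exp_atBot.comp ?_
    exact (tendsto_const_mul_atBot_of_neg (by linarith)).2 tendsto_id
  have hde : ∀ t, HasDerivAt (fun t : ℝ => Real.exp (-m * t)) (-m * Real.exp (-m * t)) t := by
    intro t
    have h1 : HasDerivAt (fun t : ℝ => -m * t) (-m) t := by
      simpa using (hasDerivAt_id t).const_mul (-m)
    exact h1.exp.congr_deriv (mul_comm _ _)
  have hpos : ∀ t ∈ Ici S, 0 < x t := fun t ht => hx t (hS0.trans_le ht)
  have hdP : ∀ t ∈ Ici S, HasDerivAt (fun t => y t + k * x t)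
      (m * (y t + k * x t) - c * x t ^ p) t := by
    intro t ht
    have ht0 := hS0.le.trans ht
    refine ((T.deriv_y t ht0).add ((T.deriv_x t ht0).const_mul k)).congr_deriv ?_
    rw [force_of_nonneg (hpos t ht).le]; ring
  have hdp : ∀ t ∈ Ici S, HasDerivAt (fun t => c / m * x t ^ p)
      (c / m * (p * x t ^ (p - 1) * y t)) t := by
    intro t ht
    have := (T.deriv_x t (hS0.le.trans ht)).rpow_const (p := p) (Or.inl (hpos t ht).ne')
    exact (this.const_mul (c / m)).congr_deriv (by ring)
  have hP0 : Tendsto (fun t => y t + k * x t) atTop (𝓝 0) := by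
    simpa using hy0.add (hx0.const_mul k)
  have hp0 : Tendsto (fun t => c / m * x t ^ p) atTop (𝓝 0) := by
    have := (hx0.rpow_const (p := p) (Or.inr (by linarith))).const_mul (c / m)
    rwa [Real.zero_rpow (by linarith), mul_zero] at this
  constructor
  -- P = y + kx is the component along the unstable direction of the saddle: P' = mP - c x^p. The
  -- integrating factor makes it decrease to the limit 0.
  · have hanti : AntitoneOn (fun t => Real.exp (-m * t) * (y t + k * x t)) (Ici S) :=
      antitoneOn_of_hasDerivAt_nonpos (convex_Ici S)
        (f' := fun t => -(Real.exp (-m * t) * (c * x t ^ p)))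
        (fun s hs => ((hde s).mul (hdP s hs)).congr_deriv (by ring))
        (fun s hs => by
          have := hpos s hs
          have : 0 ≤ Real.exp (-m * s) * (c * x s ^ p) := by positivity
          linarith)
    have hlim : Tendsto (fun t => Real.exp (-m * t) * (y t + k * x t)) atTop (𝓝 0) := by
      simpa using hexp.mul hP0
    have : 0 ≤ Real.exp (-m * t) * (y t + k * x t) := le_of_tendsto hlim (by
      filter_upwards [eventually_ge_atTop t] with s hs
      exact hanti ht (mem_Ici.2 (ht.trans hs)) hs)
    exact nonneg_of_mul_nonneg_right this (Real.exp_pos _)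
  -- Subtracting (c/m) x^p, which is nonincreasing on the tail, reverses the sign of the derivative.
  · have hmono : MonotoneOn
        (fun t => Real.exp (-m * t) * (y t + k * x t - c / m * x t ^ p)) (Ici S) :=
      monotoneOn_of_hasDerivAt_nonneg (convex_Ici S)
        (f' := fun t => Real.exp (-m * t) * (c / m * p * x t ^ (p - 1) * -y t))
        (fun s hs => ((hde s).mul ((hdP s hs).sub (hdp s hs))).congr_deriv (by
          simp only [Pi.sub_apply]; field_simp; ring))
        (fun s hs => by
          have := hpos s hs
          have : 0 ≤ -y s := by linarith [hS s hs]
          positivity)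
    have hlim : Tendsto (fun t => Real.exp (-m * t) * (y t + k * x t - c / m * x t ^ p)) atTop
        (𝓝 0) := by
      simpa using hexp.mul (hP0.sub hp0)
    have : Real.exp (-m * t) * (y t + k * x t - c / m * x t ^ p) ≤ 0 := ge_of_tendsto hlim (by
      filter_upwards [eventually_ge_atTop t] with s hs
      exact hmono ht (mem_Ici.2 (ht.trans hs)) hs)
    have := nonpos_of_mul_nonpos_right this (Real.exp_pos _)
    linarith

/-- A positive trajectory of nonnegative energy decays exactly like `exp (-k t)`. -/
lemma tendsto_exp_mul (h : Admissible m k c p) (T : IsTrajectory m k c p α x y)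
    (hx : ∀ t, 0 < t → 0 < x t) (hE : ∀ t, 0 < t → 0 ≤ energy m k c p (x t) (y t)) :
    ∃ C, 0 < C ∧ Tendsto (fun t => Real.exp (k * t) * x t) atTop (𝓝 C) := by
  have hp := h.one_lt_p
  have hc := h.c_pos
  have hm := h.m_pos
  obtain ⟨σ, S, hσ, hS0, hS⟩ := T.exists_tail h hx hE
  have hpos : ∀ t ∈ Ici S, 0 < x t := fun t ht => hx t (hS0.trans_le ht)
  have hyS : ∀ t, S ≤ t → y t ≤ 0 := fun t ht => (hS t ht).1.trans
    (by nlinarith [hpos t ht])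
  have hb := fun t (ht : S ≤ t) => T.slope_bounds h hx hE hS0 hyS ht
  have hlin : ∀ t : ℝ, HasDerivAt (fun t : ℝ => k * t) k t := fun t => by
    simpa using (hasDerivAt_id t).const_mul k
  have hmono : MonotoneOn (fun t => Real.exp (k * t) * x t) (Ici S) :=
    monotoneOn_of_hasDerivAt_nonneg (convex_Ici S)
      (f' := fun t => Real.exp (k * t) * (y t + k * x t))
      (fun s hs => ((hlin s).exp.mul (T.deriv_x s (hS0.le.trans hs))).congr_deriv (by ring))
      (fun s hs => mul_nonneg (Real.exp_pos _).le (hb s hs).1)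
  -- Chosen so that the decay of K x^(p-1), from y ≤ -σx, absorbs the growth (log(e^(kt) x))' = (y +
  -- kx)/x ≤ (c/m) x^(p-1).
  set K := c / (m * (p - 1) * σ) with hK
  have hp1 : 0 < p - 1 := by linarith
  have hK0 : 0 < K := by positivity
  have hanti : AntitoneOn (fun t => k * t + Real.log (x t) + K * x t ^ (p - 1)) (Ici S) :=
    antitoneOn_of_hasDerivAt_nonpos (convex_Ici S)
      (f' := fun t => k + y t / x t + K * (y t * (p - 1) * x t ^ (p - 1 - 1)))
      (fun s hs => ((hlin s).add ((T.deriv_x s (hS0.le.trans hs)).log (hpos s hs).ne')).add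
        (((T.deriv_x s (hS0.le.trans hs)).rpow_const (Or.inl (hpos s hs).ne')).const_mul K))
      (fun s hs => by
        have hxs := hpos s hs
        have e1 : x s ^ (p - 1 - 1) = x s ^ (p - 1) / x s := Real.rpow_sub_one hxs.ne' _
        have e2 : x s ^ p = x s ^ (p - 1) * x s := by
          rw [← Real.rpow_add_one hxs.ne']; congr 1; ring
        have h1 := (hb s hs).2
        have h2 := (hS s hs).1
        rw [e2] at h1
        set z := x s ^ (p - 1) with hz
        have hz0 : 0 < z := by positivity
        have h3 : K * (p - 1) * z * y s ≤ K * (p - 1) * z * (-σ * x s) :=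
          mul_le_mul_of_nonneg_left h2 (by positivity)
        have h4 : K * (p - 1) * z * (-σ * x s) = -(c / m * (z * x s)) := by
          rw [hK]; field_simp
        have h5 : k + y s / x s + K * (y s * (p - 1) * (z / x s)) =
            (y s + k * x s + K * (p - 1) * z * y s) / x s := by field_simp; ring
        rw [e1, h5]
        exact div_nonpos_of_nonpos_of_nonneg (by linarith) hxs.le)
  set W := k * S + Real.log (x S) + K * x S ^ (p - 1) with hW
  have hup : ∀ t, S ≤ t → Real.exp (k * t) * x t ≤ Real.exp W := by
    intro t ht
    have h1 := hanti (mem_Ici.2 le_rfl) ht ht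
    have hxt := hpos t ht
    have h2 : 0 ≤ K * x t ^ (p - 1) := by positivity
    calc Real.exp (k * t) * x t = Real.exp (k * t + Real.log (x t)) := by
          rw [Real.exp_add, Real.exp_log hxt]
      _ ≤ Real.exp W := Real.exp_le_exp.2 (by simp only at h1; linarith)
  obtain ⟨L, hL, hLle⟩ := exists_tendsto_of_antitoneOn_Ici
    (f := fun t => -(Real.exp (k * t) * x t)) (T := S) (B := -Real.exp W)
    (fun s hs t ht hst => neg_le_neg (hmono hs ht hst)) (fun t ht => neg_le_neg (hup t ht))
  refine ⟨-L, ?_, ?_⟩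
  · have h1 := hLle S le_rfl
    have h2 : 0 < Real.exp (k * S) * x S := mul_pos (Real.exp_pos _) (hpos S (mem_Ici.2 le_rfl))
    linarith
  · simpa using hL.neg

end IsTrajectory

/-! ### Uniqueness of the fast decaying slope. -/

/-- A function that decreases to `0` with negative derivative has a differentiable inverse. -/
lemma exists_inverse_of_strictAnti {f f' : ℝ → ℝ} {S : ℝ}
    (hf : ∀ t, S ≤ t → HasDerivAt f (f' t) t) (hf' : ∀ t, S ≤ t → f' t < 0)
    (hlim : Tendsto f atTop (𝓝 0)) :
    ∃ g : ℝ → ℝ, ∀ a, 0 < a → a < f S →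
      S < g a ∧ f (g a) = a ∧ HasDerivAt g (f' (g a))⁻¹ a := by
  have hanti : StrictAntiOn f (Ici S) := strictAntiOn_of_hasDerivAt_neg (convex_Ici S) hf hf'
  have hex : ∀ a, ∃ t, 0 < a → a < f S → S < t ∧ f t = a := by
    intro a
    by_cases ha : 0 < a ∧ a < f S
    · obtain ⟨t, ht1, ht2⟩ := ((hlim.eventually (gt_mem_nhds ha.1)).and
        (eventually_ge_atTop S)).exists
      obtain ⟨s, hs, hs'⟩ := intermediate_value_Icc' ht2
        (fun τ hτ => (hf τ hτ.1).continuousAt.continuousWithinAt)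
        (show a ∈ Icc (f t) (f S) from ⟨ht1.le, ha.2.le⟩)
      refine ⟨s, fun _ _ => ⟨lt_of_le_of_ne hs.1 ?_, hs'⟩⟩
      rintro rfl
      linarith [ha.2]
    · exact ⟨0, fun h1 h2 => absurd ⟨h1, h2⟩ ha⟩
  choose g hg using hex
  refine ⟨g, fun a h1 h2 => ?_⟩
  obtain ⟨h3, h4⟩ := hg a h1 h2
  refine ⟨h3, h4, HasDerivAt.of_local_left_inverse ?_ (hf _ h3.le) (hf' _ h3.le).ne ?_⟩
  · refine tendsto_order.2 ⟨fun l hl => ?_, fun u hu => ?_⟩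
    · have h5 : a < f (max l S) := by
        conv_lhs => rw [← h4]
        exact hanti (mem_Ici.2 (le_max_right _ _)) h3.le (max_lt hl h3)
      filter_upwards [Ioo_mem_nhds h1 h2, gt_mem_nhds h5] with b hb hb'
      obtain ⟨h6, h7⟩ := hg b hb.1 hb.2
      by_contra hcon
      have := hanti.antitoneOn h6.le (mem_Ici.2 (le_max_right l S))
        ((not_lt.1 hcon).trans (le_max_left _ _))
      rw [h7] at this
      exact absurd hb' (not_lt.2 this)
    · have h5 : f u < a := by
        conv_rhs => rw [← h4]
        exact hanti h3.le (mem_Ici.2 (h3.trans hu).le) hu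
      filter_upwards [Ioo_mem_nhds h1 h2, lt_mem_nhds h5] with b hb hb'
      obtain ⟨h6, h7⟩ := hg b hb.1 hb.2
      by_contra hcon
      have := hanti.antitoneOn (mem_Ici.2 (h3.trans hu).le) h6.le (not_lt.1 hcon)
      rw [h7] at this
      exact absurd hb' (not_lt.2 this)
  · filter_upwards [Ioo_mem_nhds h1 h2] with b hb
    exact (hg b hb.1 hb.2).2

namespace IsTrajectory
variable {α β : ℝ} {x₁ y₁ x₂ y₂ : ℝ → ℝ}

/-- If two positive trajectories meet, the later one is a time shift of the earlier one, which
forces equal initial slopes. -/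
lemma slope_eq_of_meet (h : Admissible m k c p) (T₁ : IsTrajectory m k c p α x₁ y₁)
    (T₂ : IsTrajectory m k c p β x₂ y₂) (hx₂ : ∀ t, 0 < t → 0 < x₂ t) {t τ : ℝ} (ht : 0 ≤ t)
    (htτ : t ≤ τ) (ex : x₁ t = x₂ τ) (ey : y₁ t = y₂ τ) : α = β := by
  have key := oscillator_unique_left h (a := 0) (b := t) (x₂ := fun s => x₂ (s + (τ - t)))
    (y₂ := fun s => y₂ (s + (τ - t)))
    (fun s hs => T₁.deriv_x s hs.1) (fun s hs => T₁.deriv_y s hs.1)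
    (fun s hs => (T₂.deriv_x (s + (τ - t)) (by linarith [hs.1])).comp_add_const s (τ - t))
    (fun s hs => (T₂.deriv_y (s + (τ - t)) (by linarith [hs.1])).comp_add_const s (τ - t))
    (by simp [ex]) (by simp [ey]) 0 ⟨le_rfl, ht⟩
  simp only [T₁.x_zero, T₁.y_zero, zero_add] at key
  -- Going back by t gives x₂(τ - t) = 0, and x₂ vanishes only at time 0.
  have : τ - t = 0 := by
    by_contra hne
    have : 0 < τ - t := lt_of_le_of_ne (by linarith) (Ne.symm hne)
    exact absurd key.1 (hx₂ _ this).ne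
  rw [this, T₂.y_zero] at key
  exact key.2

/-- At most one initial slope gives a positive trajectory of nonnegative energy. -/
lemma slope_unique (h : Admissible m k c p) (T₁ : IsTrajectory m k c p α x₁ y₁)
    (T₂ : IsTrajectory m k c p β x₂ y₂)
    (hx₁ : ∀ t, 0 < t → 0 < x₁ t) (hE₁ : ∀ t, 0 < t → 0 ≤ energy m k c p (x₁ t) (y₁ t))
    (hx₂ : ∀ t, 0 < t → 0 < x₂ t) (hE₂ : ∀ t, 0 < t → 0 ≤ energy m k c p (x₂ t) (y₂ t)) :
    α = β := by
  obtain ⟨σ₁, S₁, hσ₁, hS₁, h₁⟩ := T₁.exists_tail h hx₁ hE₁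
  obtain ⟨σ₂, S₂, hσ₂, hS₂, h₂⟩ := T₂.exists_tail h hx₂ hE₂
  have hy₂ : ∀ t, S₂ ≤ t → y₂ t < 0 := fun t ht => (h₂ t ht).1.trans_lt
    (by nlinarith [hx₂ t (hS₂.trans_le ht)])
  have hlim₁ := T₁.tendsto_x_zero h hx₁ hE₁
  have hlim₂ := T₂.tendsto_x_zero h hx₂ hE₂
  obtain ⟨g, hg⟩ := exists_inverse_of_strictAnti (fun t ht => T₂.deriv_x t (hS₂.le.trans ht))
    hy₂ hlim₂
  obtain ⟨S, hS⟩ := eventually_atTop.1 ((hlim₁.eventually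
    (gt_mem_nhds (hx₂ S₂ hS₂))).and (eventually_ge_atTop S₁))
  have hS0 : ∀ t, S ≤ t → 0 < t := fun t ht => hS₁.trans_le (hS t ht).2
  have hgt : ∀ t, S ≤ t → S₂ < g (x₁ t) ∧ x₂ (g (x₁ t)) = x₁ t ∧
      HasDerivAt g (y₂ (g (x₁ t)))⁻¹ (x₁ t) := fun t ht =>
    hg _ (hx₁ t (hS0 t ht)) (hS t ht).1
  -- The gap between the two phase curves, both read as graphs over the same x. It solves D' =
  -- (force/y₂) D with a nonnegative coefficient on the tail, so D² grows; since D → 0, it vanishes.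
  set D : ℝ → ℝ := fun t => y₂ (g (x₁ t)) - y₁ t with hD
  have hdD : ∀ t, S ≤ t → HasDerivAt D
      (force m k c p (x₁ t) / y₂ (g (x₁ t)) * D t) t := by
    intro t ht
    obtain ⟨a1, a2, a3⟩ := hgt t ht
    have h0 := (hS0 t ht).le
    have b1 : HasDerivAt (fun t => g (x₁ t)) ((y₂ (g (x₁ t)))⁻¹ * y₁ t) t :=
      a3.comp t (T₁.deriv_x t h0)
    have b2 := (T₂.deriv_y (g (x₁ t)) (hS₂.le.trans a1.le)).comp t b1
    refine (b2.sub (T₁.deriv_y t h0)).congr_deriv ?_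
    have hne := (hy₂ _ a1.le).ne
    rw [a2, hD]
    field_simp
    ring
  have hmono : MonotoneOn (fun t => D t ^ 2) (Ici S) :=
    monotoneOn_of_hasDerivAt_nonneg (convex_Ici S)
      (f' := fun t => 2 * (force m k c p (x₁ t) / y₂ (g (x₁ t))) * D t ^ 2)
      (fun t ht => ((hdD t ht).pow 2).congr_deriv (by simp; ring))
      (fun t ht => by
        have : 0 ≤ force m k c p (x₁ t) / y₂ (g (x₁ t)) :=
          div_nonneg_of_nonpos (h₁ t (hS t ht).2).2.le (hy₂ _ (hgt t ht).1.le).le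
        positivity)
  -- Squeezed by -kx ≤ y ≤ 0, so no limit of g(x₁ t) is needed.
  have hyg : Tendsto (fun t => y₂ (g (x₁ t))) atTop (𝓝 0) := by
    have hlow : Tendsto (fun t => -k * x₁ t) atTop (𝓝 0) := by simpa using hlim₁.const_mul (-k)
    refine tendsto_of_tendsto_of_tendsto_of_le_of_le' hlow tendsto_const_nhds ?_ ?_
    · filter_upwards [eventually_ge_atTop S] with t ht
      obtain ⟨a1, a2, -⟩ := hgt t ht
      have := (T₂.slope_bounds h hx₂ hE₂ hS₂ (fun t ht => (hy₂ t ht).le) a1.le).1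
      rw [a2] at this
      linarith
    · filter_upwards [eventually_ge_atTop S] with t ht
      exact (hy₂ _ (hgt t ht).1.le).le
  have hDlim : Tendsto (fun t => D t ^ 2) atTop (𝓝 0) := by
    simpa using (hyg.sub (T₁.tendsto_y_force h).1).pow 2
  have hD0 : D S ^ 2 ≤ 0 := ge_of_tendsto hDlim (by
    filter_upwards [eventually_ge_atTop S] with t ht
    exact hmono (mem_Ici.2 le_rfl) ht ht)
  have hDS : D S = 0 := pow_eq_zero_iff two_ne_zero |>.1 (le_antisymm hD0 (sq_nonneg _))
  obtain ⟨a1, a2, -⟩ := hgt S le_rfl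
  have ey : y₂ (g (x₁ S)) = y₁ S := by simpa [hD, sub_eq_zero] using hDS
  rcases le_total S (g (x₁ S)) with hle | hle
  · exact slope_eq_of_meet h T₁ T₂ hx₂ (hS0 S le_rfl).le hle a2.symm ey.symm
  · exact (slope_eq_of_meet h T₂ T₁ hx₁ (hS₂.le.trans a1.le) hle a2 ey).symm

end IsTrajectory
end

/-! ### Small slopes are trapped, some slope crosses. -/

section
variable {m k c p : ℝ}

namespace IsTrajectory
variable {α : ℝ} {x y : ℝ → ℝ}

/-- A trajectory of nonnegative energy has a first turning point. -/
lemma exists_turning (h : Admissible m k c p) (T : IsTrajectory m k c p α x y) (hα : 0 < α)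
    (hE : ∀ t, 0 ≤ t → 0 ≤ energy m k c p (x t) (y t)) :
    ∃ s, 0 < s ∧ y s = 0 ∧ ∀ t, 0 ≤ t → t < s → 0 < y t := by
  have hex : ∃ b, 0 ≤ b ∧ y b ≤ 0 := by
    by_contra hcon
    push Not at hcon
    -- Without a turning point x would increase forever, yet it must tend to 0.
    have hmono := strictMonoOn_of_hasDerivAt_pos (convex_Ici 0) T.deriv_x hcon
    have hx : ∀ t, 0 < t → 0 < x t := fun t ht => by
      have := hmono (mem_Ici.2 le_rfl) (mem_Ici.2 ht.le) ht
      rwa [T.x_zero] at this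
    have h1 : x 1 ≤ 0 := ge_of_tendsto (T.tendsto_x_zero h hx fun t ht => hE t ht.le) (by
      filter_upwards [eventually_ge_atTop 1] with t ht
      exact hmono.monotoneOn (mem_Ici.2 zero_le_one) (mem_Ici.2 (zero_le_one.trans ht)) ht)
    exact absurd (hx 1 one_pos) (not_lt.2 h1)
  obtain ⟨b, hb0, hb⟩ := hex
  obtain ⟨s, h1, -, h2, h3⟩ := exists_first_nonpos
    (T.continuousOn_y.mono Icc_subset_Ici_self) hb0 (by rw [T.y_zero]; exact hα) hb
  exact ⟨s, h1, h2, h3⟩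

end IsTrajectory

/-- The potential is quadratically negative near `0`. -/
lemma exists_potential_le (h : Admissible m k c p) :
    ∃ ξ, 0 < ξ ∧ ∀ x, 0 ≤ x → x ≤ 2 * ξ → potential m k c p x ≤ -(m * k / 4 * x ^ 2) := by
  have hp := h.one_lt_p
  have hc := h.c_pos
  have hmk := mul_pos h.m_pos h.k_pos
  have hp1 : 0 < p - 1 := by linarith
  set q := m * k * (p + 1) / (4 * c) with hq
  have hq0 : 0 < q := by positivity
  -- At x = 2ξ the power term of V is exactly half the quadratic one.
  refine ⟨q ^ (1 / (p - 1)) / 2, by positivity, fun x hx hx2 => ?_⟩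
  have h1 : x ^ (p - 1) ≤ q := by
    calc x ^ (p - 1) ≤ (q ^ (1 / (p - 1))) ^ (p - 1) := by
          apply Real.rpow_le_rpow hx _ hp1.le
          linarith
      _ = q := by
          rw [← Real.rpow_mul hq0.le, one_div_mul_cancel hp1.ne', Real.rpow_one]
  have h2 : x ^ (p + 1) = x ^ (p - 1) * x ^ 2 := by
    rcases hx.eq_or_lt with rfl | hx0
    · rw [Real.zero_rpow (by linarith)]; ring
    · rw [← Real.rpow_natCast x 2, ← Real.rpow_add hx0]; congr 1; push_cast; ring
  rw [potential_of_nonneg hx, h2]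
  have h3 : c / (p + 1) * (x ^ (p - 1) * x ^ 2) ≤ c / (p + 1) * (q * x ^ 2) := by
    have : 0 < p + 1 := by linarith
    gcongr
  have h4 : c / (p + 1) * (q * x ^ 2) = m * k / 4 * x ^ 2 := by
    have : p + 1 ≠ 0 := by linarith
    rw [hq]; field_simp
  linarith

/-- For small initial slopes the trajectory reaches negative energy. -/
lemma exists_energy_neg_of_small (h : Admissible m k c p) :
    ∃ ε, 0 < ε ∧ ∀ α, 0 < α → α < ε → ∀ x y, IsTrajectory m k c p α x y →
      ∃ t, 0 ≤ t ∧ energy m k c p (x t) (y t) < 0 := by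
  have hd := h.damping_pos
  have hmk := mul_pos h.m_pos h.k_pos
  obtain ⟨ξ, hξ, hpot⟩ := exists_potential_le h
  set δ := Real.sqrt (m * k / 2 * ξ ^ 2) with hδ
  have hδ0 : 0 < δ := Real.sqrt_pos.2 (by positivity)
  have hδ2 : δ ^ 2 = m * k / 2 * ξ ^ 2 := Real.sq_sqrt (by positivity)
  -- If the energy stayed nonnegative, x would pass from ξ to 2ξ with speed at least δ. This
  -- dissipates ∫ (k-m) y dx ≥ (k-m) δ ξ, more than the initial energy α²/2.
  refine ⟨Real.sqrt ((k - m) * δ * ξ), Real.sqrt_pos.2 (by positivity), fun α hα hαε x y T => ?_⟩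
  by_contra hcon
  push Not at hcon
  obtain ⟨s, hs0, hys, hy⟩ := T.exists_turning h hα hcon
  have hyn : ∀ t ∈ Icc 0 s, 0 ≤ y t := by
    intro t ht
    rcases ht.2.lt_or_eq with h1 | h1
    · exact (hy t ht.1 h1).le
    · rw [h1, hys]
  have hmono := monotoneOn_of_hasDerivAt_nonneg (convex_Icc 0 s) (fun t ht => T.deriv_x t ht.1) hyn
  have hxn : ∀ t ∈ Icc 0 s, 0 ≤ x t := by
    intro t ht
    have := hmono ⟨le_rfl, hs0.le⟩ ht ht.1
    rwa [T.x_zero] at this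
  have hxs : 0 < x s := lt_of_le_of_ne (hxn s ⟨hs0.le, le_rfl⟩)
    fun h0 => T.y_ne_zero_of_x_eq_zero h hα.ne' hs0.le h0.symm hys
  -- At the turning point all energy is potential, and V < 0 on (0, 2ξ].
  have hxs2 : 2 * ξ ≤ x s := by
    by_contra hlt
    have h1 := hpot (x s) hxs.le (not_le.1 hlt).le
    have h2 := hcon s hs0.le
    rw [energy, hys] at h2
    have : 0 < m * k / 4 * x s ^ 2 := by positivity
    linarith
  have hcont : ContinuousOn x (Icc 0 s) := T.continuousOn_x.mono Icc_subset_Ici_self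
  obtain ⟨t₁, ht₁, hx₁⟩ := intermediate_value_Icc hs0.le hcont
    (show ξ ∈ Icc (x 0) (x s) by rw [T.x_zero]; constructor <;> linarith)
  obtain ⟨t₂, ht₂, hx₂⟩ := intermediate_value_Icc hs0.le hcont
    (show 2 * ξ ∈ Icc (x 0) (x s) by rw [T.x_zero]; constructor <;> linarith)
  have h12 : t₁ ≤ t₂ := by
    by_contra hlt
    have := hmono ht₂ ht₁ (not_le.1 hlt).le
    linarith
  have hsub : ∀ t ∈ Icc t₁ t₂, t ∈ Icc 0 s := fun t ht => ⟨ht₁.1.trans ht.1, ht.2.trans ht₂.2⟩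
  have hanti : AntitoneOn (fun t => energy m k c p (x t) (y t) + (k - m) * δ * x t)
      (Icc t₁ t₂) :=
    antitoneOn_of_hasDerivAt_nonpos (convex_Icc t₁ t₂)
      (fun t ht => (T.hasDerivAt_energy h (hsub t ht).1).add
        ((T.deriv_x t (hsub t ht).1).const_mul _))
      (fun t ht => by
        have a1 := hmono ht₁ (hsub t ht) ht.1
        have a2 := hmono (hsub t ht) ht₂ ht.2
        rw [hx₁] at a1
        rw [hx₂] at a2
        have a3 := hpot (x t) (hxn t (hsub t ht)) a2
        have a4 := hcon t (hsub t ht).1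
        have a5 : δ ^ 2 ≤ y t ^ 2 := by
          unfold energy at a4
          have : ξ ^ 2 ≤ x t ^ 2 := by gcongr
          have : m * k * ξ ^ 2 ≤ m * k * x t ^ 2 := by gcongr
          linarith
        have a6 : δ ≤ y t := le_of_sq_le_sq a5 (hyn t (hsub t ht))
        have a7 : 0 ≤ (k - m) * y t * (y t - δ) :=
          mul_nonneg (mul_nonneg hd.le (hyn t (hsub t ht))) (sub_nonneg.2 a6)
        nlinarith)
  have h1 := hanti ⟨le_rfl, h12⟩ ⟨h12, le_rfl⟩ h12
  simp only [hx₁, hx₂] at h1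
  have h2 := hcon t₂ ht₂.1
  rw [hx₂] at h2
  have h3 := T.energy_le h ht₁.1
  rw [hx₁] at h3
  have h4 : α ^ 2 < (k - m) * δ * ξ := (Real.lt_sqrt hα.le).1 hαε
  nlinarith

/-- For some initial slope the trajectory does not stay positive. -/
lemma exists_slope_not_pos (h : Admissible m k c p) :
    ∃ α, 0 < α ∧ ∀ x y, IsTrajectory m k c p α x y → ∃ t, 0 < t ∧ x t ≤ 0 := by
  have hd := h.damping_pos
  have hp := h.one_lt_p
  have hc := h.c_pos
  have hp1 : 0 < p - 1 := by linarith
  have hmk := mul_pos h.m_pos h.k_pos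
  obtain ⟨B, hB0, hB⟩ := exists_le_potential h
  -- With s = y/x and w = c x^(p-1), s' = -s² - (k-m)s + mk - w. Once s² + w ≥ G, this is at most
  -- -(s² + 20²)/4, so arctan(s/20) falls at rate at least 5.
  set G : ℝ := 20 ^ 2 + 2 * (k - m) ^ 2 + 4 * (m * k) with hG
  have hG0 : 0 < G := by positivity
  set X : ℝ := (G / c) ^ (1 / (p - 1)) with hX
  have hX0 : 0 < X := by positivity
  -- Energy at least N ensures s² + w ≥ G: either x > X and w is large, or x ≤ X and y² ≥ G X².
  set N : ℝ := c / (p + 1) * X ^ (p + 1) + G * X ^ 2 / 2 with hN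
  have hp2 : 0 < p + 1 := by linarith
  have hN0 : 0 < N := by positivity
  set α := Real.sqrt (2 * Real.exp (4 * (k - m)) * (N + B)) with hα
  have hα0 : 0 < α := Real.sqrt_pos.2 (by positivity)
  have hα2 : α ^ 2 = 2 * Real.exp (4 * (k - m)) * (N + B) := Real.sq_sqrt (by positivity)
  refine ⟨α, hα0, fun x y T => ?_⟩
  by_contra hcon
  push Not at hcon
  -- Energy is lost at rate (k-m) y² ≤ 2(k-m)(E + B), hence at most exponentially; the factor
  -- exp(4(k-m)) in α pays for the loss up to time 2.
  have hEmono : MonotoneOn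
      (fun t => Real.exp (2 * (k - m) * t) * (energy m k c p (x t) (y t) + B)) (Ici 0) :=
    monotoneOn_of_hasDerivAt_nonneg (convex_Ici 0)
      (f' := fun t => 2 * (k - m) * Real.exp (2 * (k - m) * t) * (potential m k c p (x t) + B))
      (fun t ht => by
        have h1 : HasDerivAt (fun t : ℝ => 2 * (k - m) * t) (2 * (k - m)) t := by
          simpa using (hasDerivAt_id t).const_mul (2 * (k - m))
        refine (h1.exp.mul ((T.hasDerivAt_energy h ht).add_const B)).congr_deriv ?_
        unfold energy; ring)
      (fun t _ => by
        have : 0 ≤ potential m k c p (x t) + B := by linarith [hB (x t)]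
        positivity)
  have hEN : ∀ t ∈ Icc (1:ℝ) 2, N ≤ energy m k c p (x t) (y t) := by
    intro t ht
    have h0t : 0 ≤ t := zero_le_one.trans ht.1
    have h1 := hEmono (mem_Ici.2 le_rfl) (mem_Ici.2 h0t) h0t
    simp only [mul_zero, Real.exp_zero, one_mul] at h1
    rw [T.energy_zero h, hα2] at h1
    have h2 : Real.exp (2 * (k - m) * t) ≤ Real.exp (4 * (k - m)) :=
      Real.exp_le_exp.2 (by nlinarith [ht.2])
    have h3 : 0 < Real.exp (2 * (k - m) * t) := Real.exp_pos _
    have h4 : Real.exp (2 * (k - m) * t) * (N + B) ≤ Real.exp (4 * (k - m)) * (N + B) :=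
      mul_le_mul_of_nonneg_right h2 (by positivity)
    have h5 : Real.exp (2 * (k - m) * t) * (N + B) ≤
        Real.exp (2 * (k - m) * t) * (energy m k c p (x t) (y t) + B) := by linarith
    linarith [le_of_mul_le_mul_left h5 h3]
  have hbig : ∀ t ∈ Icc (1:ℝ) 2, G ≤ (y t / x t) ^ 2 + c * x t ^ (p - 1) := by
    intro t ht
    have hxt := hcon t (one_pos.trans_le ht.1)
    have hw0 : 0 ≤ c * x t ^ (p - 1) := by positivity
    by_contra hlt
    have hlt := not_le.1 hlt
    have h1 : x t ^ (p - 1) ≤ G / c := by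
      rw [le_div_iff₀ hc]; nlinarith [sq_nonneg (y t / x t)]
    have h2 : x t ≤ X := by
      calc x t = (x t ^ (p - 1)) ^ (1 / (p - 1)) := by
            rw [← Real.rpow_mul hxt.le, mul_one_div_cancel hp1.ne', Real.rpow_one]
        _ ≤ X := Real.rpow_le_rpow (by positivity) h1 (by positivity)
    have h3 := hEN t ht
    rw [energy, potential_of_nonneg hxt.le] at h3
    have h4 : c / (p + 1) * x t ^ (p + 1) ≤ c / (p + 1) * X ^ (p + 1) := by gcongr
    have h5 : 0 ≤ m * k / 2 * x t ^ 2 := by positivity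
    have h6 : G * X ^ 2 ≤ y t ^ 2 := by linarith
    have h7 : G * x t ^ 2 ≤ G * X ^ 2 := by gcongr
    have h8 : G ≤ (y t / x t) ^ 2 := by
      rw [div_pow, le_div_iff₀ (by positivity)]; linarith
    linarith
  have hanti : AntitoneOn (fun t => Real.arctan (y t / x t / 20) + 5 * t) (Icc 1 2) :=
    antitoneOn_of_hasDerivAt_nonpos (convex_Icc 1 2)
      (f' := fun t => 1 / (1 + (y t / x t / 20) ^ 2) *
        (((-(k - m) * y t - force m k c p (x t)) * x t - y t * y t) / x t ^ 2 / 20) + 5 * 1)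
      (fun t ht => by
        have h0t : 0 ≤ t := zero_le_one.trans ht.1
        have hxt := hcon t (one_pos.trans_le ht.1)
        exact ((((T.deriv_y t h0t).div (T.deriv_x t h0t) hxt.ne').div_const 20).arctan).add
          ((hasDerivAt_id t).const_mul 5))
      (fun t ht => by
        have hxt := hcon t (one_pos.trans_le ht.1)
        have hb := hbig t ht
        have e2 : x t ^ p = x t ^ (p - 1) * x t := by
          rw [← Real.rpow_add_one hxt.ne']; congr 1; ring
        have e3 : ((-(k - m) * y t - force m k c p (x t)) * x t - y t * y t) / x t ^ 2 =
            -(y t / x t) ^ 2 - (k - m) * (y t / x t) + m * k - c * x t ^ (p - 1) := by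
          rw [force_of_nonneg hxt.le, e2]; field_simp; ring
        rw [e3]
        have hw0 : 0 ≤ c * x t ^ (p - 1) := by positivity
        set s := y t / x t
        set w := c * x t ^ (p - 1)
        have e4 : -s ^ 2 - (k - m) * s + m * k - w ≤ -(s ^ 2 + 20 ^ 2) / 4 := by
          nlinarith [sq_nonneg (s + (k - m))]
        have e5 : 0 < 1 + (s / 20) ^ 2 := by positivity
        rw [one_div_mul_eq_div, mul_one, ← le_neg_iff_add_nonpos_right, div_le_iff₀ e5]
        nlinarith)
  -- Over unit time arctan would drop by at least 5, but its range has length π < 4.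
  have h1 := hanti (show (1:ℝ) ∈ Icc (1:ℝ) 2 by norm_num) (show (2:ℝ) ∈ Icc (1:ℝ) 2 by norm_num)
    one_le_two
  simp only at h1
  have h2 := Real.neg_pi_div_two_lt_arctan (y 2 / x 2 / 20)
  have h3 := Real.arctan_lt_pi_div_two (y 1 / x 1 / 20)
  have h4 := Real.pi_lt_four
  linarith

/-! ### The separating slope. -/

/-- The slopes whose trajectories become negative. -/
def crossingSet (m k c p : ℝ) : Set ℝ :=
  {α | ∃ x y, IsTrajectory m k c p α x y ∧ ∃ t, 0 ≤ t ∧ x t < 0}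

/-- The slopes whose trajectories reach negative energy. -/
def trappedSet (m k c p : ℝ) : Set ℝ :=
  {α | ∃ x y, IsTrajectory m k c p α x y ∧ ∃ t, 0 ≤ t ∧ energy m k c p (x t) (y t) < 0}

/-- A strict inequality at a single time survives a small change of slope; this is why the crossing
is recorded by x < 0 and not by x = 0. -/
lemma isOpen_crossingSet (h : Admissible m k c p) : IsOpen (crossingSet m k c p) := by
  rw [Metric.isOpen_iff]
  rintro α ⟨x, y, T, t, ht, hx⟩
  obtain ⟨δ, hδ, hnear⟩ := T.dist_lt_of_near h ht (neg_pos.2 hx)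
  refine ⟨δ, hδ, fun β hβ => ?_⟩
  obtain ⟨x', y', T'⟩ := exists_isTrajectory h β
  have := (abs_lt.1 (hnear β hβ x' y' T').1).2
  exact ⟨x', y', T', t, ht, by linarith⟩

lemma isOpen_trappedSet (h : Admissible m k c p) : IsOpen (trappedSet m k c p) := by
  have hopen : IsOpen {z : ℝ × ℝ | energy m k c p z.1 z.2 < 0} := by
    refine isOpen_lt ?_ continuous_const
    unfold energy
    exact ((continuous_snd.pow 2).div_const 2).add ((continuous_potential h).comp continuous_fst)
  rw [Metric.isOpen_iff] at hopen ⊢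
  rintro α ⟨x, y, T, t, ht, hE⟩
  obtain ⟨ε, hε, hball⟩ := hopen (x t, y t) hE
  obtain ⟨δ, hδ, hnear⟩ := T.dist_lt_of_near h ht hε
  refine ⟨δ, hδ, fun β hβ => ?_⟩
  obtain ⟨x', y', T'⟩ := exists_isTrajectory h β
  obtain ⟨h1, h2⟩ := hnear β hβ x' y' T'
  refine ⟨x', y', T', t, ht, hball (a := (x' t, y' t)) ?_⟩
  rw [Metric.mem_ball, Prod.dist_eq, max_lt_iff]
  exact ⟨h1, h2⟩

/-- The energy is nonnegative wherever x ≤ 0, hence from the first zero on; being nonincreasing, it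
was nonnegative before as well. -/
lemma notMem_trappedSet_of_crossing (h : Admissible m k c p) {α : ℝ} (hα : 0 < α)
    (hc : α ∈ crossingSet m k c p) : α ∉ trappedSet m k c p := by
  rintro ⟨x, y, T, t, ht, hE⟩
  obtain ⟨x', y', T', t', ht', hx'⟩ := hc
  rw [← (T.unique h T' ht').1] at hx'
  rcases T.pos_or_crosses h hα with hpos | ⟨s, hs0, hxs, hys, hpos, hneg⟩
  · rcases ht'.eq_or_lt with rfl | h0
    · exact absurd T.x_zero hx'.ne
    · exact absurd (hpos t' h0) (not_lt.2 hx'.le)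
  · have hnn : ∀ τ, x τ ≤ 0 → 0 ≤ energy m k c p (x τ) (y τ) := fun τ hτ => by
      rw [energy, potential_of_nonpos h hτ]; positivity
    rcases le_total t s with hts | hts
    · have h1 := T.antitoneOn_energy h ht (mem_Ici.2 hs0.le) hts
      have h2 := hnn s hxs.le
      simp only at h1
      linarith
    · have : x t ≤ 0 := by
        rcases hts.eq_or_lt with rfl | h1
        · exact hxs.le
        · exact (hneg t h1).le
      linarith [hnn t this]

/-- The phase portrait: one slope separates the trapped from the crossing trajectories, and it
belongs to a positive trajectory of nonnegative energy. -/
theorem exists_separating_slope (h : Admissible m k c p) :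
    ∃ a, 0 < a ∧
      (∀ x y, IsTrajectory m k c p a x y →
        (∀ t, 0 < t → 0 < x t) ∧ ∀ t, 0 < t → 0 ≤ energy m k c p (x t) (y t)) ∧
      (∀ α, a < α → α ∈ crossingSet m k c p) ∧
      (∀ α, 0 < α → α < a → α ∈ trappedSet m k c p) := by
  have htri : ∀ α, 0 < α → α ∈ crossingSet m k c p ∨ α ∈ trappedSet m k c p ∨
      ∀ x y, IsTrajectory m k c p α x y →
        (∀ t, 0 < t → 0 < x t) ∧ ∀ t, 0 < t → 0 ≤ energy m k c p (x t) (y t) := by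
    intro α hα
    by_cases h1 : α ∈ crossingSet m k c p
    · exact Or.inl h1
    by_cases h2 : α ∈ trappedSet m k c p
    · exact Or.inr (Or.inl h2)
    refine Or.inr (Or.inr fun x y T => ⟨?_, fun t ht => ?_⟩)
    · rcases T.pos_or_crosses h hα with hpos | ⟨s, hs0, -, -, -, hneg⟩
      · exact hpos
      · exact absurd ⟨x, y, T, s + 1, by linarith, hneg _ (by linarith)⟩ h1
    · by_contra hlt
      exact h2 ⟨x, y, T, t, ht.le, not_le.1 hlt⟩
  obtain ⟨ε, hε, hsmall⟩ := exists_energy_neg_of_small h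
  have hsmall' : ∀ α, 0 < α → α < ε → α ∈ trappedSet m k c p := fun α h0 h1 => by
    obtain ⟨x, y, T⟩ := exists_isTrajectory h α
    exact ⟨x, y, T, hsmall α h0 h1 x y T⟩
  obtain ⟨A, hA0, hA⟩ := exists_slope_not_pos h
  have hA' : A ∈ crossingSet m k c p := by
    obtain ⟨x, y, T⟩ := exists_isTrajectory h A
    obtain ⟨t, ht, hxt⟩ := hA x y T
    rcases T.pos_or_crosses h hA0 with hpos | ⟨s, hs0, -, -, -, hneg⟩
    · exact absurd (hpos t ht) (not_lt.2 hxt)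
    · exact ⟨x, y, T, s + 1, by linarith, hneg _ (by linarith)⟩
  have hconn : ∀ s : Set ℝ, IsPreconnected s → s ⊆ Ioi 0 →
      s ⊆ crossingSet m k c p ∪ trappedSet m k c p → (s ∩ crossingSet m k c p).Nonempty →
      (s ∩ trappedSet m k c p).Nonempty → False := by
    intro s hs hs0 hcov h1 h2
    obtain ⟨α, hα, hα1, hα2⟩ :=
      hs _ _ (isOpen_crossingSet h) (isOpen_trappedSet h) hcov h1 h2
    exact notMem_trappedSet_of_crossing h (hs0 hα) hα1 hα2
  obtain ⟨a, ha0, ha1, ha2⟩ : ∃ a, 0 < a ∧ a ∉ crossingSet m k c p ∧ a ∉ trappedSet m k c p := by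
    by_contra hcon
    push Not at hcon
    refine hconn (Ioi 0) isPreconnected_Ioi subset_rfl (fun α hα => ?_) ⟨A, hA0, hA'⟩
      ⟨ε / 2, by simpa using hε, hsmall' _ (by linarith) (by linarith)⟩
    by_cases h1 : α ∈ crossingSet m k c p
    · exact Or.inl h1
    · exact Or.inr (hcon α hα h1)
  have hafast := ((htri a ha0).resolve_left ha1).resolve_left ha2
  obtain ⟨xa, ya, Ta⟩ := exists_isTrajectory h a
  have hcov : ∀ α, 0 < α → α ≠ a → α ∈ crossingSet m k c p ∪ trappedSet m k c p := by
    intro α hα hne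
    rcases htri α hα with h1 | h1 | h1
    · exact Or.inl h1
    · exact Or.inr h1
    · obtain ⟨x, y, T⟩ := exists_isTrajectory h α
      exact absurd (T.slope_unique h Ta (h1 x y T).1 (h1 x y T).2 (hafast xa ya Ta).1
        (hafast xa ya Ta).2) hne
  have hεa : ε ≤ a := by
    by_contra hlt
    exact ha2 (hsmall' a ha0 (not_le.1 hlt))
  have hlow : ∀ α, 0 < α → α < a → α ∈ trappedSet m k c p := by
    intro α h0 h1
    rcases hcov α h0 h1.ne with h2 | h2
    · exfalso
      exact hconn (Ioo 0 a) isPreconnected_Ioo (fun β hβ => hβ.1)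
        (fun β hβ => hcov β hβ.1 hβ.2.ne) ⟨α, ⟨h0, h1⟩, h2⟩
        ⟨ε / 2, ⟨by linarith, by linarith⟩, hsmall' _ (by linarith) (by linarith)⟩
    · exact h2
  -- Puts a crossing slope into (a, ∞), as connectedness there requires.
  have haA : a < A := by
    rcases lt_trichotomy a A with h1 | h1 | h1
    · exact h1
    · exact absurd (h1 ▸ hA') ha1
    · exact absurd (hlow A hA0 h1) (notMem_trappedSet_of_crossing h hA0 hA')
  refine ⟨a, ha0, hafast, fun α hα => ?_, hlow⟩
  rcases hcov α (ha0.trans hα) hα.ne' with h2 | h2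
  · exact h2
  · exfalso
    exact hconn (Ioi a) isPreconnected_Ioi (fun β hβ => ha0.trans hβ)
      (fun β hβ => hcov β (ha0.trans hβ) (ne_of_gt hβ)) ⟨A, haA, hA'⟩ ⟨α, hα, h2⟩

end

/-! ### The Emden–Fowler change of variables `x(t) = r ^ m u(r)`, `r = exp t` -/

/-- The exponent `2 / (p - 1)` of the scaling invariance. -/
noncomputable def scalingExp (p : ℝ) : ℝ := 2 / (p - 1)

/-- The radial profile of a phase curve. -/
noncomputable def radialProfile (p : ℝ) (x : ℝ → ℝ) (r : ℝ) : ℝ :=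
  r ^ (-scalingExp p) * x (Real.log r)

section
variable {ν p lam α : ℝ}

lemma one_lt_of_supercritical (hν : 2 < ν) (hp : (ν + 2) / (ν - 2) < p) : 1 < p := by
  refine lt_trans ?_ hp
  rw [lt_div_iff₀ (by linarith)]; linarith

/-- Positive friction means 4/(p-1) < ν-2, that is (ν-2)p > ν+2. -/
lemma admissible_of_supercritical (hν : 2 < ν) (hlam : 0 < lam) (hp : (ν + 2) / (ν - 2) < p) :
    Admissible (scalingExp p) (ν - 2 - scalingExp p) lam⁻¹ p := by
  have hp1 := one_lt_of_supercritical hν hp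
  have hp0 : 0 < p - 1 := by linarith
  refine ⟨by unfold scalingExp; positivity, ?_, inv_pos.2 hlam, hp1⟩
  rw [div_lt_iff₀ (by linarith)] at hp
  have h1 : scalingExp p * (p - 1) = 2 := div_mul_cancel₀ _ hp0.ne'
  by_contra hcon
  have h2 : (ν - 2) * (p - 1) ≤ 2 * scalingExp p * (p - 1) :=
    mul_le_mul_of_nonneg_right (by linarith) hp0.le
  nlinarith

/-- The identity of exponents that makes the transformed equation autonomous. -/
lemma scalingExp_mul (hp1 : 1 < p) : scalingExp p * p = scalingExp p + 2 := by
  have h1 : scalingExp p * (p - 1) = 2 := div_mul_cancel₀ _ (by linarith)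
  linarith

/-- The profile of a trajectory solves the radial equation as long as it is positive. -/
lemma isPositiveSolution_radialProfile (hp1 : 1 < p) {x y : ℝ → ℝ}
    (T : IsTrajectory (scalingExp p) (ν - 2 - scalingExp p) lam⁻¹ p α x y) {ρ : EReal}
    (hρ : 1 < ρ) (hpos : ∀ r : ℝ, 1 < r → (r : EReal) < ρ → 0 < x (Real.log r)) :
    IsPositiveSolution ν p lam α ρ (radialProfile p x) := by
  set m := scalingExp p with hm
  have hX : ∀ r : ℝ, 1 ≤ r → HasDerivAt (fun r => x (Real.log r)) (y (Real.log r) / r) r := by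
    intro r hr
    have hr0 : 0 < r := by linarith
    exact ((T.deriv_x _ (Real.log_nonneg hr)).comp r (Real.hasDerivAt_log hr0.ne')).congr_deriv
      (div_eq_mul_inv _ _).symm
  have hY : ∀ r : ℝ, 1 ≤ r → HasDerivAt (fun r => y (Real.log r))
      ((-(ν - 2 - m - m) * y (Real.log r) -
        force m (ν - 2 - m) lam⁻¹ p (x (Real.log r))) / r) r := by
    intro r hr
    have hr0 : 0 < r := by linarith
    exact ((T.deriv_y _ (Real.log_nonneg hr)).comp r (Real.hasDerivAt_log hr0.ne')).congr_deriv
      (div_eq_mul_inv _ _).symm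
  have hU : ∀ r : ℝ, 1 ≤ r → HasDerivAt (radialProfile p x)
      (r ^ (-m - 1) * (y (Real.log r) - m * x (Real.log r))) r := by
    intro r hr
    have hr0 : 0 < r := by linarith
    refine ((Real.hasDerivAt_rpow_const (p := -m) (Or.inl hr0.ne')).mul (hX r hr)).congr_deriv ?_
    rw [Real.rpow_sub_one hr0.ne']
    field_simp
    ring
  have hV : ∀ r : ℝ, 1 ≤ r → HasDerivAt
      (fun r => r ^ (-m - 1) * (y (Real.log r) - m * x (Real.log r)))
      ((-m - 1) * r ^ (-m - 1 - 1) * (y (Real.log r) - m * x (Real.log r)) +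
        r ^ (-m - 1) * ((-(ν - 2 - m - m) * y (Real.log r) -
          force m (ν - 2 - m) lam⁻¹ p (x (Real.log r))) / r - m * (y (Real.log r) / r))) r := by
    intro r hr
    have hr0 : 0 < r := by linarith
    exact (Real.hasDerivAt_rpow_const (p := -m - 1) (Or.inl hr0.ne')).mul
      ((hY r hr).sub ((hX r hr).const_mul m))
  refine ⟨hρ, fun r h1 h2 => ?_, by simp [radialProfile, T.x_zero],
    fun r => r ^ (-m - 1) * (y (Real.log r) - m * x (Real.log r)),
    fun r h1 _ => (hU r h1).hasDerivWithinAt, by simp [T.x_zero, T.y_zero],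
    (hV 1 le_rfl).continuousAt.continuousWithinAt, fun r h1 h2 => ⟨_, hV r h1.le, ?_⟩⟩
  · have := hpos r h1 h2
    have hr0 : 0 < r := by linarith
    unfold radialProfile
    positivity
  · have hx := hpos r h1 h2
    have hr0 : 0 < r := by linarith
    have e1 : (radialProfile p x r) ^ p = r ^ (-m - 1 - 1) * x (Real.log r) ^ p := by
      rw [radialProfile, ← hm, Real.mul_rpow (by positivity) hx.le, ← Real.rpow_mul hr0.le]
      congr 2
      have := scalingExp_mul hp1
      rw [← hm] at this
      linarith
    have e2 : r ^ (-m - 1) = r ^ (-m - 1 - 1) * r := by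
      rw [← Real.rpow_add_one hr0.ne']; congr 1; ring
    beta_reduce
    rw [e1, force_of_nonneg hx.le, e2]
    field_simp
    ring

/-- Every positive solution is the profile of the trajectory with the same slope. -/
lemma IsPositiveSolution.eq_radialProfile (hν : 2 < ν) (hlam : 0 < lam)
    (hp : (ν + 2) / (ν - 2) < p) {x y : ℝ → ℝ}
    (T : IsTrajectory (scalingExp p) (ν - 2 - scalingExp p) lam⁻¹ p α x y) {ρ : EReal}
    {u : ℝ → ℝ} (hu : IsPositiveSolution ν p lam α ρ u) {r : ℝ} (hr : 1 ≤ r)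
    (hrρ : (r : EReal) < ρ) : u r = radialProfile p x r := by
  have hA := admissible_of_supercritical hν hlam hp
  have hp1 := one_lt_of_supercritical hν hp
  rcases hr.eq_or_lt with rfl | hr1
  · simp [hu.initial, radialProfile, T.x_zero]
  obtain ⟨v, hdu, hv1, hvc, hode⟩ := hu.ode
  set m := scalingExp p with hm
  have hmp : m * p = m + 2 := scalingExp_mul hp1
  have hle : ∀ s : ℝ, s ≤ r → (s : EReal) < ρ := fun s hs =>
    lt_of_le_of_lt (EReal.coe_le_coe_iff.2 hs) hrρ
  have hunn : ∀ s : ℝ, 1 ≤ s → s ≤ r → 0 ≤ u s := by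
    intro s h1 h2
    rcases h1.eq_or_lt with rfl | h1
    · exact hu.initial.ge
    · exact (hu.pos s h1 (hle s h2)).le
  have hdv : ∀ s : ℝ, 1 ≤ s → s ≤ r →
      HasDerivWithinAt v (-(u s ^ p / lam) - (ν - 1) * (v s / s)) (Ici 1) s := by
    intro s h1 h2
    have hin : ∀ s : ℝ, 1 < s → s ≤ r →
        HasDerivAt v (-(u s ^ p / lam) - (ν - 1) * (v s / s)) s := by
      intro s h1 h2
      obtain ⟨w, hw, hweq⟩ := hode s h1 (hle s h2)
      exact hw.congr_deriv (by linarith)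
    rcases h1.eq_or_lt with rfl | h1
    -- The equation is not assumed at r = 1. There v' has a limit from the right, which by
    -- continuity of v is its one-sided derivative.
    · have hsub : 𝓝[>] (1:ℝ) ≤ 𝓝[≥] 1 := nhdsWithin_mono _ Ioi_subset_Ici_self
      have hut : Tendsto u (𝓝[>] 1) (𝓝 (u 1)) :=
        (hdu 1 le_rfl (hle 1 hr)).continuousWithinAt.tendsto.mono_left hsub
      have hvt : Tendsto v (𝓝[>] 1) (𝓝 (v 1)) := hvc.tendsto.mono_left hsub
      have hid : Tendsto (fun s : ℝ => s) (𝓝[>] (1:ℝ)) (𝓝 1) := nhdsWithin_le_nhds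
      refine hasDerivWithinAt_Ici_of_tendsto_deriv (s := Ioo 1 r)
        (fun s hs => (hin s hs.1 hs.2.le).differentiableAt.differentiableWithinAt)
        (hvc.mono fun s hs => hs.1.le) (Ioo_mem_nhdsGT hr1) ?_
      have hlim := ((hut.rpow_const (p := p) (Or.inr (by linarith))).div_const lam).neg.sub
        ((hvt.div hid one_ne_zero).const_mul (ν - 1))
      refine hlim.congr' ?_
      filter_upwards [Ioo_mem_nhdsGT hr1] with s hs
      rw [(hin s hs.1 hs.2.le).deriv]
      rfl
    · exact (hin s h1 h2).hasDerivWithinAt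
  set b := Real.log r with hb
  have hb0 : 0 < b := Real.log_pos hr1
  have hexp : ∀ t ∈ Icc 0 b, 1 ≤ Real.exp t ∧ Real.exp t ≤ r := fun t ht =>
    ⟨Real.one_le_exp ht.1, by
      rw [← Real.exp_log (show 0 < r by linarith)]; exact Real.exp_le_exp.2 ht.2⟩
  have hmaps : MapsTo Real.exp (Ici 0) (Ici 1) := fun t ht => Real.one_le_exp ht
  have hemt : ∀ t, HasDerivAt (fun t : ℝ => Real.exp (m * t)) (m * Real.exp (m * t)) t := by
    intro t
    have h1 : HasDerivAt (fun t : ℝ => m * t) m t := by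
      simpa using (hasDerivAt_id t).const_mul m
    exact h1.exp.congr_deriv (mul_comm _ _)
  set ξ : ℝ → ℝ := fun t => Real.exp (m * t) * u (Real.exp t) with hξ
  set η : ℝ → ℝ := fun t =>
    Real.exp (m * t) * (m * u (Real.exp t) + Real.exp t * v (Real.exp t)) with hη
  have hue : ∀ t ∈ Icc 0 b, HasDerivWithinAt (fun t => u (Real.exp t))
      (v (Real.exp t) * Real.exp t) (Ici 0) t := fun t ht =>
    (hdu _ (hexp t ht).1 (hle _ (hexp t ht).2)).comp t (Real.hasDerivAt_exp t).hasDerivWithinAt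
      hmaps
  have hve : ∀ t ∈ Icc 0 b, HasDerivWithinAt (fun t => v (Real.exp t))
      ((-(u (Real.exp t) ^ p / lam) - (ν - 1) * (v (Real.exp t) / Real.exp t)) * Real.exp t)
      (Ici 0) t := fun t ht =>
    (hdv _ (hexp t ht).1 (hexp t ht).2).comp t (Real.hasDerivAt_exp t).hasDerivWithinAt hmaps
  have hdξ : ∀ t ∈ Icc 0 b, HasDerivWithinAt ξ (η t) (Ici 0) t := fun t ht =>
    ((hemt t).hasDerivWithinAt.mul (hue t ht)).congr_deriv (by simp only [hη]; ring)
  have hdη : ∀ t ∈ Icc 0 b, HasDerivWithinAt η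
      (-(ν - 2 - m - m) * η t - force m (ν - 2 - m) lam⁻¹ p (ξ t)) (Ici 0) t := by
    intro t ht
    have hu0 := hunn _ (hexp t ht).1 (hexp t ht).2
    refine ((hemt t).hasDerivWithinAt.mul (((hue t ht).const_mul m).add
      ((Real.hasDerivAt_exp t).hasDerivWithinAt.mul (hve t ht)))).congr_deriv ?_
    have e1 : ξ t ^ p = Real.exp (m * t) * Real.exp t * Real.exp t * u (Real.exp t) ^ p := by
      rw [hξ]
      simp only
      rw [Real.mul_rpow (Real.exp_pos _).le hu0, ← Real.exp_mul, ← Real.exp_add, ← Real.exp_add]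
      congr 2
      linear_combination t * hmp
    rw [force_of_nonneg (by positivity), e1]
    have := (Real.exp_pos t).ne'
    simp only [hξ, hη, Pi.add_apply, Pi.mul_apply]
    field_simp
    ring
  have hIci : ∀ {f : ℝ → ℝ} {f' : ℝ} {t : ℝ}, t ∈ Ico 0 b → HasDerivWithinAt f f' (Ici 0) t →
      HasDerivWithinAt f f' (Ici t) t := fun ht hf => hf.mono (Ici_subset_Ici.2 ht.1)
  have key := oscillator_unique_right hA (a := 0) (b := b)
    (fun t ht => (hdξ t ht).continuousWithinAt.mono Icc_subset_Ici_self)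
    (fun t ht => (hdη t ht).continuousWithinAt.mono Icc_subset_Ici_self)
    (T.continuousOn_x.mono Icc_subset_Ici_self) (T.continuousOn_y.mono Icc_subset_Ici_self)
    (fun t ht => hIci ht (hdξ t (Ico_subset_Icc_self ht)))
    (fun t ht => hIci ht (hdη t (Ico_subset_Icc_self ht)))
    (fun t ht => (T.deriv_x t ht.1).hasDerivWithinAt)
    (fun t ht => (T.deriv_y t ht.1).hasDerivWithinAt)
    (by simp [hξ, hu.initial, T.x_zero]) (by simp [hη, hu.initial, hv1, T.y_zero])
    b ⟨hb0.le, le_rfl⟩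
  have hr0 : 0 < r := by linarith
  have e2 : x b = r ^ m * u r := by
    rw [← key.1, hξ]
    simp only
    rw [hb, Real.exp_log hr0, Real.rpow_def_of_pos hr0, mul_comm m]
  rw [radialProfile, ← hb, e2, ← mul_assoc, ← hm, ← Real.rpow_add hr0, neg_add_cancel,
    Real.rpow_zero, one_mul]

/-! ### Maximal positive solutions. -/

/-- The maximal positive solution is unique. -/
lemma IsMaximalPositiveSolution.unique (hν : 2 < ν) (hlam : 0 < lam)
    (hp : (ν + 2) / (ν - 2) < p) {ρ₁ ρ₂ : EReal} {u₁ u₂ : ℝ → ℝ}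
    (h₁ : IsMaximalPositiveSolution ν p lam α ρ₁ u₁)
    (h₂ : IsMaximalPositiveSolution ν p lam α ρ₂ u₂) :
    ρ₁ = ρ₂ ∧ ∀ r : ℝ, 1 ≤ r → (r : EReal) < ρ₁ → u₁ r = u₂ r := by
  obtain ⟨x, y, T⟩ := exists_isTrajectory (admissible_of_supercritical hν hlam hp) α
  have hagree : ∀ r : ℝ, 1 ≤ r → (r : EReal) < ρ₁ → (r : EReal) < ρ₂ → u₁ r = u₂ r :=
    fun r h h' h'' => (h₁.sol.eq_radialProfile hν hlam hp T h h').trans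
      (h₂.sol.eq_radialProfile hν hlam hp T h h'').symm
  have hρ : ρ₁ = ρ₂ := by
    rcases le_total ρ₁ ρ₂ with hle | hle
    · exact (h₁.maximal ρ₂ u₂ h₂.sol hle
        fun r hr hlt => (hagree r hr hlt (hlt.trans_le hle)).symm).symm
    · exact h₂.maximal ρ₁ u₁ h₁.sol hle fun r hr hlt => hagree r hr (hlt.trans_le hle) hlt
  exact ⟨hρ, fun r hr hlt => hagree r hr hlt (hρ ▸ hlt)⟩

/-- A trajectory that stays positive gives a global maximal positive solution. -/
lemma isMaximalPositiveSolution_top (hp1 : 1 < p) {x y : ℝ → ℝ}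
    (T : IsTrajectory (scalingExp p) (ν - 2 - scalingExp p) lam⁻¹ p α x y)
    (hx : ∀ t, 0 < t → 0 < x t) :
    IsMaximalPositiveSolution ν p lam α ⊤ (radialProfile p x) :=
  ⟨isPositiveSolution_radialProfile hp1 T (by exact_mod_cast EReal.coe_lt_top 1)
    fun _ hr _ => hx _ (Real.log_pos hr), fun _ _ _ h _ => top_le_iff.1 h⟩

/-- A trajectory with first zero `s` gives a maximal positive solution on `[1, exp s)`. -/
lemma isMaximalPositiveSolution_exp (hν : 2 < ν) (hlam : 0 < lam)
    (hp : (ν + 2) / (ν - 2) < p) {x y : ℝ → ℝ}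
    (T : IsTrajectory (scalingExp p) (ν - 2 - scalingExp p) lam⁻¹ p α x y) {s : ℝ} (hs : 0 < s)
    (hxs : x s = 0) (hx : ∀ t, 0 < t → t < s → 0 < x t) :
    IsMaximalPositiveSolution ν p lam α (Real.exp s : ℝ) (radialProfile p x) := by
  have h1 : 1 < Real.exp s := Real.one_lt_exp_iff.2 hs
  refine ⟨isPositiveSolution_radialProfile (one_lt_of_supercritical hν hp) T
    (by exact_mod_cast h1) fun r hr hlt => hx _ (Real.log_pos hr) ?_, fun ρ' w hw hle _ => ?_⟩
  · rw [Real.log_lt_iff_lt_exp (by linarith)]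
    exact_mod_cast hlt
  · by_contra hne
    have hlt : ((Real.exp s : ℝ) : EReal) < ρ' := lt_of_le_of_ne hle (Ne.symm hne)
    -- A longer solution would be positive at exp s, where it must agree with the vanishing profile.
    have h2 := hw.pos _ h1 hlt
    rw [hw.eq_radialProfile hν hlam hp T h1.le hlt, radialProfile, Real.log_exp, hxs,
      mul_zero] at h2
    exact lt_irrefl _ h2

/-- A trajectory that becomes negative has a finite maximal positive solution that vanishes at
the end of its interval. -/
lemma exists_finite_of_mem_crossingSet (hν : 2 < ν) (hlam : 0 < lam)
    (hp : (ν + 2) / (ν - 2) < p) (hα : 0 < α)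
    (hc : α ∈ crossingSet (scalingExp p) (ν - 2 - scalingExp p) lam⁻¹ p) :
    ∃ (R : ℝ) (U : ℝ → ℝ), 1 < R ∧ IsMaximalPositiveSolution ν p lam α (R : EReal) U ∧
      Tendsto U (𝓝[<] R) (𝓝 0) := by
  have hA := admissible_of_supercritical hν hlam hp
  obtain ⟨x, y, T, t, ht, hxt⟩ := hc
  rcases T.pos_or_crosses hA hα with hpos | ⟨s, hs, hxs, -, hpos, -⟩
  · rcases ht.eq_or_lt with rfl | h0
    · exact absurd T.x_zero hxt.ne
    · exact absurd (hpos t h0) (not_lt.2 hxt.le)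
  · refine ⟨Real.exp s, radialProfile p x, Real.one_lt_exp_iff.2 hs,
      isMaximalPositiveSolution_exp hν hlam hp T hs hxs hpos, ?_⟩
    have hcont : ContinuousAt (radialProfile p x) (Real.exp s) := by
      have h0 := (Real.exp_pos s).ne'
      refine (Real.continuousAt_rpow_const _ _ (Or.inl h0)).mul ?_
      refine ContinuousAt.comp (g := x) ?_ (Real.continuousAt_log h0)
      rw [Real.log_exp]
      exact (T.deriv_x s hs.le).continuousAt
    have := hcont.tendsto
    rw [radialProfile, Real.log_exp, hxs, mul_zero] at this
    exact this.mono_left nhdsWithin_le_nhds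

/-- For q = m the exponential disappears and x itself is left; for q = ν-2 its rate is k. -/
lemma rpow_mul_radialProfile {x : ℝ → ℝ} {r q : ℝ} (hr : 0 < r) :
    r ^ q * radialProfile p x r = Real.exp ((q - scalingExp p) * Real.log r) * x (Real.log r) := by
  rw [radialProfile, ← mul_assoc, ← Real.rpow_add hr, Real.rpow_def_of_pos hr, ← sub_eq_add_neg,
    mul_comm (Real.log r)]

end

theorem proposition6p2 (ν p lam : ℝ) (hν : 2 < ν) (hlam : 0 < lam)
    (hp : (ν + 2) / (ν - 2) < p) :
    -- for each slope the maximal positive solution exists and is unique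
    (∀ α : ℝ, 0 < α →
      (∃ (ρ : EReal) (u : ℝ → ℝ), IsMaximalPositiveSolution ν p lam α ρ u) ∧
      ∀ (ρ₁ ρ₂ : EReal) (u₁ u₂ : ℝ → ℝ), IsMaximalPositiveSolution ν p lam α ρ₁ u₁ →
        IsMaximalPositiveSolution ν p lam α ρ₂ u₂ →
        ρ₁ = ρ₂ ∧ ∀ r : ℝ, 1 ≤ r → (r : EReal) < ρ₁ → u₁ r = u₂ r) ∧
    -- the infimum that defines the critical slope is over a nonempty set
    (crossingSlopes ν p lam).Nonempty ∧
    -- (i)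
    0 < criticalSlope ν p lam ∧
    -- (ii)
    (∀ α : ℝ, criticalSlope ν p lam < α → ∀ (ρ : EReal) (u : ℝ → ℝ),
      IsMaximalPositiveSolution ν p lam α ρ u →
        ∃ R : ℝ, ρ = (R : EReal) ∧ Tendsto u (𝓝[<] R) (𝓝 0)) ∧
    -- (iii)
    (∀ (ρ : EReal) (u : ℝ → ℝ),
      IsMaximalPositiveSolution ν p lam (criticalSlope ν p lam) ρ u →
        ρ = ⊤ ∧ ∃ C : ℝ, 0 < C ∧ Tendsto (fun r : ℝ => r ^ (ν - 2) * u r) atTop (𝓝 C)) ∧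
    -- uniqueness of the fast decaying solution
    (∀ α : ℝ, 0 < α → ∀ u : ℝ → ℝ, IsMaximalPositiveSolution ν p lam α ⊤ u →
      (∃ C : ℝ, 0 < C ∧ Tendsto (fun r : ℝ => r ^ (ν - 2) * u r) atTop (𝓝 C)) →
        α = criticalSlope ν p lam) ∧
    -- (iv)
    (∀ α : ℝ, 0 < α → α < criticalSlope ν p lam → ∀ (ρ : EReal) (u : ℝ → ℝ),
      IsMaximalPositiveSolution ν p lam α ρ u →
        ρ = ⊤ ∧ Tendsto (fun r : ℝ => r ^ (2 / (p - 1)) * u r) atTop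
          (𝓝 ((2 * lam * ((ν - 2) * p - ν) / (p - 1) ^ 2) ^ (1 / (p - 1))))) := by
  have hA := admissible_of_supercritical hν hlam hp
  have hp1 := one_lt_of_supercritical hν hp
  obtain ⟨a, ha0, hfast, hcross, htrap⟩ := exists_separating_slope hA
  have hupper : ∀ α, a < α → ∀ (ρ : EReal) (u : ℝ → ℝ), IsMaximalPositiveSolution ν p lam α ρ u →
      ∃ R : ℝ, ρ = (R : EReal) ∧ Tendsto u (𝓝[<] R) (𝓝 0) := by
    intro α hα ρ u hu
    obtain ⟨R, U, hR, hU, hlim⟩ :=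
      exists_finite_of_mem_crossingSet hν hlam hp (ha0.trans hα) (hcross α hα)
    obtain ⟨hρ, heq⟩ := hU.unique hν hlam hp hu
    refine ⟨R, hρ.symm, hlim.congr' ?_⟩
    filter_upwards [Ioo_mem_nhdsLT hR] with r hr
    exact heq r hr.1.le (by exact_mod_cast hr.2)
  have hlower : ∀ α, 0 < α → α ≤ a → ∀ x y,
      IsTrajectory (scalingExp p) (ν - 2 - scalingExp p) lam⁻¹ p α x y →
      ∀ t, 0 < t → 0 < x t := by
    intro α hα hαa x y T
    rcases hαa.eq_or_lt with rfl | hlt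
    · exact (hfast x y T).1
    · rcases T.pos_or_crosses hA hα with hpos | ⟨s, hs, -, -, -, hneg⟩
      · exact hpos
      · exact absurd (htrap α hα hlt) (notMem_trappedSet_of_crossing hA hα
          ⟨x, y, T, s + 1, by linarith, hneg _ (by linarith)⟩)
  have htop : ∀ α, 0 < α → α ≤ a → ∀ x y,
      IsTrajectory (scalingExp p) (ν - 2 - scalingExp p) lam⁻¹ p α x y →
      ∀ (ρ : EReal) (u : ℝ → ℝ), IsMaximalPositiveSolution ν p lam α ρ u →
      ρ = ⊤ ∧ ∀ r : ℝ, 1 ≤ r → u r = radialProfile p x r := by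
    intro α hα hαa x y T ρ u hu
    obtain ⟨hρ, heq⟩ := hu.unique hν hlam hp
      (isMaximalPositiveSolution_top hp1 T (hlower α hα hαa x y T))
    exact ⟨hρ, fun r hr => heq r hr (hρ ▸ EReal.coe_lt_top r)⟩
  have hslow : ∀ α, 0 < α → α < a → ∀ (ρ : EReal) (u : ℝ → ℝ),
      IsMaximalPositiveSolution ν p lam α ρ u →
        ρ = ⊤ ∧ Tendsto (fun r : ℝ => r ^ (2 / (p - 1)) * u r) atTop
          (𝓝 ((2 * lam * ((ν - 2) * p - ν) / (p - 1) ^ 2) ^ (1 / (p - 1)))) := by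
    intro α hα hαa ρ u hu
    obtain ⟨x, y, T, t₀, ht₀, hE⟩ := htrap α hα hαa
    obtain ⟨hρ, heq⟩ := htop α hα hαa.le x y T ρ u hu
    refine ⟨hρ, ?_⟩
    have hlim := (T.tendsto_x_equilibrium hA (hlower α hα hαa.le x y T) ht₀ hE).comp
      Real.tendsto_log_atTop
    have hval : scalingExp p * (ν - 2 - scalingExp p) / lam⁻¹ =
        2 * lam * ((ν - 2) * p - ν) / (p - 1) ^ 2 := by
      have : p - 1 ≠ 0 := by linarith
      unfold scalingExp
      field_simp
      ring
    rw [hval] at hlim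
    refine hlim.congr' ?_
    filter_upwards [eventually_ge_atTop 1] with r hr
    rw [heq r hr, rpow_mul_radialProfile (by linarith), show 2 / (p - 1) = scalingExp p from rfl]
    simp
  -- The infimum is not attained: the slope a itself gives a global solution.
  have hset : crossingSlopes ν p lam = Ioi a := by
    ext α
    constructor
    · rintro ⟨hα, ρ, u, hu, hlt⟩
      by_contra hle
      obtain ⟨x, y, T⟩ := exists_isTrajectory hA α
      exact absurd (htop α hα (not_lt.1 hle) x y T ρ u hu).1 hlt.ne
    · intro hα
      obtain ⟨R, U, -, hU, -⟩ :=
        exists_finite_of_mem_crossingSet hν hlam hp (ha0.trans hα) (hcross α hα)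
      exact ⟨ha0.trans hα, R, U, hU, EReal.coe_lt_top R⟩
  have hcrit : criticalSlope ν p lam = a := by rw [criticalSlope, hset, csInf_Ioi]
  rw [hcrit, hset]
  refine ⟨fun α hα => ⟨?_, fun ρ₁ ρ₂ u₁ u₂ h₁ h₂ => h₁.unique hν hlam hp h₂⟩, nonempty_Ioi, ha0,
    hupper, fun ρ u hu => ?_, fun α hα u hu hC => ?_, hslow⟩
  · rcases le_or_gt α a with hle | hlt
    · obtain ⟨x, y, T⟩ := exists_isTrajectory hA α
      exact ⟨⊤, _, isMaximalPositiveSolution_top hp1 T (hlower α hα hle x y T)⟩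
    · obtain ⟨R, U, -, hU, -⟩ := exists_finite_of_mem_crossingSet hν hlam hp hα (hcross α hlt)
      exact ⟨R, U, hU⟩
  · obtain ⟨x, y, T⟩ := exists_isTrajectory hA a
    obtain ⟨hρ, heq⟩ := htop a ha0 le_rfl x y T ρ u hu
    obtain ⟨C, hC, hlim⟩ := T.tendsto_exp_mul hA (hfast x y T).1 (hfast x y T).2
    refine ⟨hρ, C, hC, (hlim.comp Real.tendsto_log_atTop).congr' ?_⟩
    filter_upwards [eventually_ge_atTop 1] with r hr
    rw [heq r hr, rpow_mul_radialProfile (by linarith)]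
    rfl
  · obtain ⟨C, hC, hlim⟩ := hC
    rcases lt_trichotomy α a with hlt | heq | hgt
    · exfalso
      have h1 := (hslow α hα hlt ⊤ u hu).2
      -- Fast decay times r^(-k) gives limit 0, against the positive limit of slow decay.
      have h2 : Tendsto (fun r : ℝ => r ^ (2 / (p - 1)) * u r) atTop (𝓝 0) := by
        have h3 := (tendsto_rpow_neg_atTop hA.k_pos).mul hlim
        rw [zero_mul] at h3
        refine h3.congr' ?_
        filter_upwards [eventually_gt_atTop 0] with r hr
        rw [← mul_assoc, ← Real.rpow_add hr]
        congr 2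
        unfold scalingExp
        ring
      have h4 := tendsto_nhds_unique h1 h2
      have h5 : 0 < (ν - 2) * p - ν := by
        rw [div_lt_iff₀ (by linarith)] at hp
        nlinarith
      have h6 : 0 < p - 1 := by linarith
      have : 0 < (2 * lam * ((ν - 2) * p - ν) / (p - 1) ^ 2) ^ (1 / (p - 1)) := by positivity
      linarith
    · exact heq
    · obtain ⟨R, hR, -⟩ := hupper α hgt ⊤ u hu
      exact absurd hR (EReal.coe_ne_top R).symm
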